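/- **Calculi.** Processes of both calculi are taken up to $\alpha$-conversion. We say that $P$ diverges, $P\to^{\omega}$, if there is an infinite sequence $P=P_0\to P_1\to P_2\to\cdots$. The $\rho$-calculus has processes $P ::= 0 \mid P_1|P_2 \mid x\langle P\rangle \mid x(y).P \mid {*x}$ (nil, parallel, lift, input, drop), and its names are quoted processes $\ulcorner P\urcorner$. Structural congruence $\equiv$ is the least congruence making $|$ an abelian monoid with unit $0$ (names being compared up to $\equiv_N$), and name equivalence $\equiv_N$ is the least equivalence such that $P_1\equiv P_2$ implies $\ulcorner P_1\urcorner\equiv_N\ulcorner P_2\urcorner$ and $x_1\equiv_N x_2$ implies $\ulcorner {*x_1}\urcorner\equiv_N x_2$. Reduction is the least relation closed under parallel contexts and $\equiv$ such that $x_1(y).P_1\mid x_2\langle P_2\rangle\to P_1\{\ulcorner P_2\urcorner/y\}$ whenever $x_1\equiv_N x_2$, where substitution does not enter quotes and $({*y})\{\ulcorner P_2\urcorner/y\}=P_2$. This is a *communication on $x_1$*. The $\pi$-calculus is the asynchronous choice-free one with input-guarded replication only, $P ::= 0\mid P_1|P_2\mid x(y).P\mid \bar x\langle z\rangle\mid (\nu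 x)P\mid {!x(y).P}$, with its usual structural congruence and reduction relation. Its atomic names are implemented as $\rho$-names that are pairwise not name equivalent. **Encoding.** For $\rho$-names let $x^{l}=\ulcorner x\langle 0\rangle\urcorner$, $x^{r}=\ulcorner x(\ulcorner 0\urcorner).0\urcorner$, $x^{2}=\ulcorner x\langle 0\rangle\mid x(\ulcorner 0\urcorner).0\urcorner$, $D(x)=x(y).({*y}\mid x\langle {*y}\rangle)$ and $\bar x\langle y\rangle=x\langle {*y}\rangle$. The translation of $\pi$-processes with parameters $n,v$ is $$[\![0]\!]_{n,v}=0,\quad [\![P_1|P_2]\!]_{n,v}=[\![P_1]\!]_{n^{l},v}\mid[\![P_2]\!]_{n^{r},v},\quad [\![x(y).P]\!]_{n,v}=x(y).[\![P]\!]_{n,v},\quad [\![\bar x\langle z\rangle]\!]_{n,v}=\bar x\langle z\rangle,$$ $$[\![(\nu x)P]\!]_{n,v}=\bar v\langle n\rangle\mid n(x).[\![P]\!]_{n^{2},v},\qquad [\![!x(y).P]\!]_{n,v}=D(n)\mid n\langle x(y).(D(n)\mid[\![P]\!]_{n^{2},v})\rangle,$$ where the bound names of $P$ are chosen so that they capture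 no parameter. The name server is $$\mathit{NS}(x,z,v,s)=D(x)\mid x\langle z(a).v(r).(D(x)\mid r\langle {*a}\rangle\mid z\langle a\langle 0\rangle\rangle)\rangle\mid z\langle {*s}\rangle,$$ and $[\![P]\!]=[\![P]\!]_{n,v}\mid\mathit{NS}(x,z,v,s)$. Let $\mathcal N(n)$ be the set of names generated from $n$ by the operations $(\cdot)^{l},(\cdot)^{r},(\cdot)^{2}$, and $\mathcal L(s)$ the set of those generated from $s$ by $(\cdot)^{l}$, both up to $\equiv_N$. The parameters are assumed to be chosen such that $v,x,z$ are pairwise not name equivalent; $n,v,x,z\notin\mathcal L(s)$; $s,v,x,z\notin\mathcal N(n)$; and no free name of $P$ is name equivalent to $v$, $x$ or $z$ or belongs to $\mathcal N(n)\cup\mathcal L(s)$. **Proposition (Divergence reflection).** Let $P$ be a $\pi$-process and let $n,v,x,z,s$ be chosen as above. Then $$[\![P]\!]\to^{\omega}\ \Longrightarrow\ P\to^{\omega}.$$ Moreover, administrative steps are always finite: for no $T$ with $[\![P]\!]\to^{*}T$ is there an infinite reduction sequence from $T$ all of whose steps are communications on administrative names, i.e. on names that are name equivalent to $x$ or $z$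 (internal steps of the name server) or $v$ (name requests) or belong to $\mathcal N(n)$ (answers to name requests, unfolding of replicated inputs). -/

import Mathlib

/-- `a` has an infinite `r`-reduction sequence. -/
def Diverges {α : Type*} (r : α → α → Prop) (a : α) : Prop :=
  ∃ f : ℕ → α, f 0 = a ∧ ∀ i, r (f i) (f (i + 1))

/-! ## The rho-calculus

Terms are represented up to alpha-conversion: `Proc k` is the type of processes in the scope of `k`
input binders, bound names being de Bruijn indices. Every free name is a quoted process. Since
substitution never enters a quote, the process under a quote has no bound name of its context. -/

namespace RhoCalc

mutual
inductive Proc : ℕ → Type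
  | nil {k : ℕ} : Proc k
  | par {k : ℕ} (P Q : Proc k) : Proc k
  | lift {k : ℕ} (x : Name k) (P : Proc k) : Proc k
  | input {k : ℕ} (x : Name k) (P : Proc (k + 1)) : Proc k
  | drop {k : ℕ} (x : Name k) : Proc k
inductive Name : ℕ → Type
  | bound {k : ℕ} (i : Fin k) : Name k
  | quote {k : ℕ} (P : Proc 0) : Name k
end

/-- Renaming of bound names; quotes are left untouched. -/
def Name.rename {k m : ℕ} (ρ : Fin k → Fin m) : Name k → Name m
  | .bound i => .bound (ρ i)
  | .quote P => .quote P

/-- A name without bound names, used in the scope of `k` binders. -/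
def Name.up {k : ℕ} (x : Name 0) : Name k := x.rename Fin.elim0

def liftRen {k m : ℕ} (ρ : Fin k → Fin m) : Fin (k + 1) → Fin (m + 1) :=
  Fin.cases 0 (fun i => (ρ i).succ)

def Proc.rename : {k m : ℕ} → (Fin k → Fin m) → Proc k → Proc m
  | _, _, _, .nil => .nil
  | _, _, ρ, .par P Q => .par (P.rename ρ) (Q.rename ρ)
  | _, _, ρ, .lift x P => .lift (x.rename ρ) (P.rename ρ)
  | _, _, ρ, .input x P => .input (x.rename ρ) (P.rename (liftRen ρ))
  | _, _, ρ, .drop x => .drop (x.rename ρ)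

def Proc.up {k : ℕ} (P : Proc 0) : Proc k := P.rename Fin.elim0

/-- A semantic substitution sends each bound name either to a bound name or to the quote of a
process. -/
abbrev Sub (k m : ℕ) : Type := Fin k → Fin m ⊕ Proc 0

def liftSub {k m : ℕ} (σ : Sub k m) : Sub (k + 1) (m + 1) :=
  Fin.cases (Sum.inl 0) (fun i => Sum.map Fin.succ id (σ i))

def Name.subst {k m : ℕ} (σ : Sub k m) : Name k → Name m
  | .bound i => match σ i with
    | .inl j => .bound j
    | .inr Q => .quote Q
  | .quote P => .quote P

/-- The process that results from substituting in the process dropping a name: if the name is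
replaced by a quoted process, then that process is run. -/
def Name.substDrop {k m : ℕ} (σ : Sub k m) : Name k → Proc m
  | .bound i => match σ i with
    | .inl j => .drop (.bound j)
    | .inr Q => Q.up
  | .quote P => .drop (.quote P)

/-- Semantic substitution. It acts on the object of a lift, but not under quotes. -/
def Proc.subst : {k m : ℕ} → Sub k m → Proc k → Proc m
  | _, _, _, .nil => .nil
  | _, _, σ, .par P Q => .par (P.subst σ) (Q.subst σ)
  | _, _, σ, .lift x P => .lift (x.subst σ) (P.subst σ)
  | _, _, σ, .input x P => .input (x.subst σ) (P.subst (liftSub σ))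
  | _, _, σ, .drop x => x.substDrop σ

/-- Replacement of the outermost bound name of `P` by the quote of `Q`. -/
def Proc.inst (P : Proc 1) (Q : Proc 0) : Proc 0 := P.subst (fun _ => Sum.inr Q)

/- Structural congruence of processes and name equivalence. -/
mutual
inductive Proc.Cong : {k : ℕ} → Proc k → Proc k → Prop
  | refl {k : ℕ} (P : Proc k) : Proc.Cong P P
  | symm {k : ℕ} {P Q : Proc k} : Proc.Cong P Q → Proc.Cong Q P
  | trans {k : ℕ} {P Q R : Proc k} : Proc.Cong P Q → Proc.Cong Q R → Proc.Cong P R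
  | par_nil {k : ℕ} (P : Proc k) : Proc.Cong (.par P .nil) P
  | par_comm {k : ℕ} (P Q : Proc k) : Proc.Cong (.par P Q) (.par Q P)
  | par_assoc {k : ℕ} (P Q R : Proc k) :
      Proc.Cong (.par (.par P Q) R) (.par P (.par Q R))
  | par {k : ℕ} {P₁ P₂ Q₁ Q₂ : Proc k} :
      Proc.Cong P₁ P₂ → Proc.Cong Q₁ Q₂ → Proc.Cong (.par P₁ Q₁) (.par P₂ Q₂)
  | lift {k : ℕ} {x₁ x₂ : Name k} {P₁ P₂ : Proc k} :
      Name.Equiv x₁ x₂ → Proc.Cong P₁ P₂ → Proc.Cong (.lift x₁ P₁) (.lift x₂ P₂)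
  | input {k : ℕ} {x₁ x₂ : Name k} {P₁ P₂ : Proc (k + 1)} :
      Name.Equiv x₁ x₂ → Proc.Cong P₁ P₂ → Proc.Cong (.input x₁ P₁) (.input x₂ P₂)
  | drop {k : ℕ} {x₁ x₂ : Name k} :
      Name.Equiv x₁ x₂ → Proc.Cong (.drop x₁) (.drop x₂)
inductive Name.Equiv : {k : ℕ} → Name k → Name k → Prop
  | refl {k : ℕ} (x : Name k) : Name.Equiv x x
  | symm {k : ℕ} {x y : Name k} : Name.Equiv x y → Name.Equiv y x
  | trans {k : ℕ} {x y w : Name k} : Name.Equiv x y → Name.Equiv y w → Name.Equiv x w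
  | struct {k : ℕ} {P₁ P₂ : Proc 0} :
      Proc.Cong P₁ P₂ → Name.Equiv (k := k) (.quote P₁) (.quote P₂)
  | drop {k : ℕ} {x₁ : Name 0} {P₂ : Proc 0} :
      Name.Equiv x₁ (.quote P₂) → Name.Equiv (k := k) (.quote (.drop x₁)) (.quote P₂)
end

/-- The reduction relation. -/
inductive Step : Proc 0 → Proc 0 → Prop
  | com {x₁ x₂ : Name 0} (P₁ : Proc 1) (P₂ : Proc 0) :
      Name.Equiv x₁ x₂ → Step (.par (.input x₁ P₁) (.lift x₂ P₂)) (P₁.inst P₂)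
  | par {P₁ P₁' : Proc 0} (P₂ : Proc 0) : Step P₁ P₁' → Step (.par P₁ P₂) (.par P₁' P₂)
  | struct {P₁ P₁' P₂' P₂ : Proc 0} :
      Proc.Cong P₁ P₁' → Step P₁' P₂' → Proc.Cong P₂' P₂ → Step P₁ P₂

/-- Reduction by a communication on a name in `A`. -/
inductive StepOn (A : Set (Name 0)) : Proc 0 → Proc 0 → Prop
  | com {x₁ x₂ : Name 0} (P₁ : Proc 1) (P₂ : Proc 0) :
      Name.Equiv x₁ x₂ → x₁ ∈ A →
      StepOn A (.par (.input x₁ P₁) (.lift x₂ P₂)) (P₁.inst P₂)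
  | par {P₁ P₁' : Proc 0} (P₂ : Proc 0) :
      StepOn A P₁ P₁' → StepOn A (.par P₁ P₂) (.par P₁' P₂)
  | struct {P₁ P₁' P₂' P₂ : Proc 0} :
      Proc.Cong P₁ P₁' → StepOn A P₁' P₂' → Proc.Cong P₂' P₂ → StepOn A P₁ P₂

/-- Left increment of a name. -/
def leftIncr (x : Name 0) : Name 0 := .quote (.lift x .nil)

/-- Right increment of a name. -/
def rightIncr (x : Name 0) : Name 0 := .quote (.input x .nil)

/-- Composition of two names. -/
def compose (x y : Name 0) : Name 0 := .quote (.par (.lift x .nil) (.input y .nil))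

/-- The names built from `n` by left increments, right increments and self-composition. -/
inductive Generated (n : Name 0) : Name 0 → Prop
  | root : Generated n n
  | left {m : Name 0} : Generated n m → Generated n (leftIncr m)
  | right {m : Name 0} : Generated n m → Generated n (rightIncr m)
  | compose {m : Name 0} : Generated n m → Generated n (compose m m)

/-- The names derivable from `n`, up to name equivalence. -/
def namespaceOf (n : Name 0) : Set (Name 0) := {m | ∃ m', Generated n m' ∧ Name.Equiv m m'}

/-- The namespace of left increments rooted at `s`, up to name equivalence. -/
def leftNamespace (s : Name 0) : Set (Name 0) := {m | ∃ i : ℕ, Name.Equiv m (leftIncr^[i] s)}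

/-- Output of the name `y` on `x`: the lift on `x` of the drop of `y`. -/
def output {k : ℕ} (x y : Name k) : Proc k := .lift x (.drop y)

/-- The copying process on `x`: receive a process on `x`, run it and send it on `x` again. -/
def copier {k : ℕ} (x : Name 0) : Proc k :=
  .input x.up (.par (.drop (.bound 0)) (.lift x.up (.drop (.bound 0))))

/-- The process on which the name server loops: input of `a` on `z`, then input of `r` on `v`.
Below, `r` is index `0` and `a` is index `1`. -/
def serverBody (v x z : Name 0) : Proc 0 :=
  .input z (.input v.up
    (.par (.par (copier x) (.lift (.bound 0) (.drop (.bound 1))))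
      (.lift z.up (.lift (.bound 1) .nil))))

/-- The name server in its initial state. -/
def nameServer (v x z s : Name 0) : Proc 0 :=
  .par (.par (copier x) (.lift x (serverBody v x z))) (.lift z (.drop s))

end RhoCalc

/-! ## The asynchronous choice-free pi-calculus with input-guarded replication -/

namespace PiCalc

/-- Names in the scope of `k` binders: atomic free names, or bound names as de Bruijn indices. -/
inductive Name (𝒩 : Type*) (k : ℕ) : Type _
  | free (a : 𝒩) : Name 𝒩 k
  | bound (i : Fin k) : Name 𝒩 k

/-- Processes up to alpha-conversion; `input x P` and `repl x P` bind the received name in `P`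
(so `repl x P` is the replication of the input), `nu P` binds the new name in `P`. -/
inductive Proc (𝒩 : Type*) : ℕ → Type _
  | nil {k : ℕ} : Proc 𝒩 k
  | par {k : ℕ} (P Q : Proc 𝒩 k) : Proc 𝒩 k
  | input {k : ℕ} (x : Name 𝒩 k) (P : Proc 𝒩 (k + 1)) : Proc 𝒩 k
  | output {k : ℕ} (x y : Name 𝒩 k) : Proc 𝒩 k
  | nu {k : ℕ} (P : Proc 𝒩 (k + 1)) : Proc 𝒩 k
  | repl {k : ℕ} (x : Name 𝒩 k) (P : Proc 𝒩 (k + 1)) : Proc 𝒩 k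

def Name.subst {𝒩 : Type*} {k m : ℕ} (σ : Fin k → Name 𝒩 m) : Name 𝒩 k → Name 𝒩 m
  | .free a => .free a
  | .bound i => σ i

def liftSub {𝒩 : Type*} {k m : ℕ} (σ : Fin k → Name 𝒩 m) : Fin (k + 1) → Name 𝒩 (m + 1) :=
  Fin.cases (.bound 0) (fun i => (σ i).subst (fun j => .bound j.succ))

/-- Substitution of names for bound names. -/
def Proc.subst {𝒩 : Type*} : {k m : ℕ} → (Fin k → Name 𝒩 m) → Proc 𝒩 k → Proc 𝒩 m
  | _, _, _, .nil => .nil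
  | _, _, σ, .par P Q => .par (P.subst σ) (Q.subst σ)
  | _, _, σ, .input x P => .input (x.subst σ) (P.subst (liftSub σ))
  | _, _, σ, .output x y => .output (x.subst σ) (y.subst σ)
  | _, _, σ, .nu P => .nu (P.subst (liftSub σ))
  | _, _, σ, .repl x P => .repl (x.subst σ) (P.subst (liftSub σ))

/-- Replacement of the last bound name by `y`. -/
def Proc.inst {𝒩 : Type*} {k : ℕ} (P : Proc 𝒩 (k + 1)) (y : Name 𝒩 k) : Proc 𝒩 k :=
  P.subst (Fin.cases y Name.bound)

/-- `P` in the scope of one more binder, whose name does not occur in it. -/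
def Proc.weaken {𝒩 : Type*} {k : ℕ} (P : Proc 𝒩 k) : Proc 𝒩 (k + 1) :=
  P.subst (fun i => .bound i.succ)

/-- Exchange of the two last bound names. -/
def Proc.swap {𝒩 : Type*} {k : ℕ} (P : Proc 𝒩 (k + 2)) : Proc 𝒩 (k + 2) :=
  P.subst (fun i => .bound (Equiv.swap 0 1 i))

/-- Structural congruence. -/
inductive Proc.Cong {𝒩 : Type*} : {k : ℕ} → Proc 𝒩 k → Proc 𝒩 k → Prop
  | refl {k : ℕ} (P : Proc 𝒩 k) : Proc.Cong P P
  | symm {k : ℕ} {P Q : Proc 𝒩 k} : Proc.Cong P Q → Proc.Cong Q P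
  | trans {k : ℕ} {P Q R : Proc 𝒩 k} : Proc.Cong P Q → Proc.Cong Q R → Proc.Cong P R
  | par_nil {k : ℕ} (P : Proc 𝒩 k) : Proc.Cong (.par P .nil) P
  | par_comm {k : ℕ} (P Q : Proc 𝒩 k) : Proc.Cong (.par P Q) (.par Q P)
  | par_assoc {k : ℕ} (P Q R : Proc 𝒩 k) :
      Proc.Cong (.par (.par P Q) R) (.par P (.par Q R))
  | nu_nil {k : ℕ} : Proc.Cong (.nu (.nil : Proc 𝒩 (k + 1))) .nil
  | nu_nu {k : ℕ} (P : Proc 𝒩 (k + 2)) : Proc.Cong (.nu (.nu P)) (.nu (.nu P.swap))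
  | nu_par {k : ℕ} (P : Proc 𝒩 (k + 1)) (Q : Proc 𝒩 k) :
      Proc.Cong (.par (.nu P) Q) (.nu (.par P Q.weaken))
  | repl_unfold {k : ℕ} (x : Name 𝒩 k) (P : Proc 𝒩 (k + 1)) :
      Proc.Cong (.repl x P) (.par (.input x P) (.repl x P))
  | par {k : ℕ} {P₁ P₂ Q₁ Q₂ : Proc 𝒩 k} :
      Proc.Cong P₁ P₂ → Proc.Cong Q₁ Q₂ → Proc.Cong (.par P₁ Q₁) (.par P₂ Q₂)
  | input {k : ℕ} (x : Name 𝒩 k) {P₁ P₂ : Proc 𝒩 (k + 1)} :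
      Proc.Cong P₁ P₂ → Proc.Cong (.input x P₁) (.input x P₂)
  | nu {k : ℕ} {P₁ P₂ : Proc 𝒩 (k + 1)} : Proc.Cong P₁ P₂ → Proc.Cong (.nu P₁) (.nu P₂)
  | repl {k : ℕ} (x : Name 𝒩 k) {P₁ P₂ : Proc 𝒩 (k + 1)} :
      Proc.Cong P₁ P₂ → Proc.Cong (.repl x P₁) (.repl x P₂)

/-- The reduction relation. -/
inductive Step {𝒩 : Type*} : {k : ℕ} → Proc 𝒩 k → Proc 𝒩 k → Prop
  | com {k : ℕ} (x y : Name 𝒩 k) (P : Proc 𝒩 (k + 1)) :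
      Step (.par (.input x P) (.output x y)) (P.inst y)
  | par {k : ℕ} {P₁ P₁' : Proc 𝒩 k} (P₂ : Proc 𝒩 k) :
      Step P₁ P₁' → Step (.par P₁ P₂) (.par P₁' P₂)
  | res {k : ℕ} {P P' : Proc 𝒩 (k + 1)} : Step P P' → Step (.nu P) (.nu P')
  | struct {k : ℕ} {P₁ P₁' P₂' P₂ : Proc 𝒩 k} :
      Proc.Cong P₁ P₁' → Step P₁' P₂' → Proc.Cong P₂' P₂ → Step P₁ P₂

/-- The free name, if any, that a name is. -/
def Name.freeNames {𝒩 : Type*} {k : ℕ} : Name 𝒩 k → Set 𝒩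
  | .free a => {a}
  | .bound _ => ∅

/-- The free names of a process. -/
def Proc.freeNames {𝒩 : Type*} : {k : ℕ} → Proc 𝒩 k → Set 𝒩
  | _, .nil => ∅
  | _, .par P Q => P.freeNames ∪ Q.freeNames
  | _, .input x P => x.freeNames ∪ P.freeNames
  | _, .output x y => x.freeNames ∪ y.freeNames
  | _, .nu P => P.freeNames
  | _, .repl x P => x.freeNames ∪ P.freeNames

end PiCalc

/-! ## The encoding -/

namespace PiToRho

/-- Pi-calculus names as rho-calculus names, for an implementation `φ` of the atomic names. -/
def transName {𝒩 : Type*} (φ : 𝒩 → RhoCalc.Name 0) {k : ℕ} : PiCalc.Name 𝒩 k → RhoCalc.Name k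
  | .free a => (φ a).up
  | .bound i => .bound i

/-- The translation of a process with the parameters `n` and `v`. -/
def trans {𝒩 : Type*} (φ : 𝒩 → RhoCalc.Name 0) (v : RhoCalc.Name 0) :
    {k : ℕ} → PiCalc.Proc 𝒩 k → RhoCalc.Name 0 → RhoCalc.Proc k
  | _, .nil, _ => .nil
  | _, .par P Q, n =>
      .par (trans φ v P (RhoCalc.leftIncr n)) (trans φ v Q (RhoCalc.rightIncr n))
  | _, .input x P, n => .input (transName φ x) (trans φ v P n)
  | _, .output x y, _ => RhoCalc.output (transName φ x) (transName φ y)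
  | _, .nu P, n =>
      .par (RhoCalc.output v.up n.up) (.input n.up (trans φ v P (RhoCalc.compose n n)))
  | _, .repl x P, n =>
      .par (RhoCalc.copier n)
        (.lift n.up (.input (transName φ x)
          (.par (RhoCalc.copier n) (trans φ v P (RhoCalc.compose n n)))))

/-- The encoding: the translated process in parallel with the name server. -/
def encode {𝒩 : Type*} (φ : 𝒩 → RhoCalc.Name 0) (P : PiCalc.Proc 𝒩 0)
    (n v x z s : RhoCalc.Name 0) : RhoCalc.Proc 0 :=
  .par (trans φ v P n) (RhoCalc.nameServer v x z s)

/-- The parameters of the encoding are suitably chosen for `P`: they are distinct, none of `n`, `v`,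
`x`, `z` is among the names that the server generates, none of `s`, `v`, `x`, `z` is derivable from
`n`, and no free name of `P` is a parameter or belongs to one of the two namespaces. -/
structure Fresh {𝒩 : Type*} (φ : 𝒩 → RhoCalc.Name 0) (P : PiCalc.Proc 𝒩 0)
    (n v x z s : RhoCalc.Name 0) : Prop where
  v_ne_x : ¬ RhoCalc.Name.Equiv v x
  v_ne_z : ¬ RhoCalc.Name.Equiv v z
  x_ne_z : ¬ RhoCalc.Name.Equiv x z
  n_server : n ∉ RhoCalc.leftNamespace s
  v_server : v ∉ RhoCalc.leftNamespace s
  x_server : x ∉ RhoCalc.leftNamespace s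
  z_server : z ∉ RhoCalc.leftNamespace s
  s_derived : s ∉ RhoCalc.namespaceOf n
  v_derived : v ∉ RhoCalc.namespaceOf n
  x_derived : x ∉ RhoCalc.namespaceOf n
  z_derived : z ∉ RhoCalc.namespaceOf n
  free_v : ∀ a ∈ P.freeNames, ¬ RhoCalc.Name.Equiv (φ a) v
  free_x : ∀ a ∈ P.freeNames, ¬ RhoCalc.Name.Equiv (φ a) x
  free_z : ∀ a ∈ P.freeNames, ¬ RhoCalc.Name.Equiv (φ a) z
  free_server : ∀ a ∈ P.freeNames, φ a ∉ RhoCalc.leftNamespace s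
  free_derived : ∀ a ∈ P.freeNames, φ a ∉ RhoCalc.namespaceOf n

/-- The names on which the administrative communications take place: `x` and `z` (internal steps of
the name server), `v` (requests for a new name), and the names derivable from `n` (answers to such
requests, unfolding of replications). -/
def adminNames (n v x z : RhoCalc.Name 0) : Set (RhoCalc.Name 0) :=
  {c | RhoCalc.Name.Equiv c v ∨ RhoCalc.Name.Equiv c x ∨ RhoCalc.Name.Equiv c z} ∪
    RhoCalc.namespaceOf n

end PiToRho

-- Every process reachable from the encoding is a parallel composition of components of a few fixed
-- shapes (`Item`): translated inputs and outputs, requests, undelivered answers, restrictions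
-- awaiting their name, the parts of replications and of the server. Read back by `Item.toPi`, they
-- form a π-process: bookkeeping components mean nil, a waiting restriction means `νP`, a stored
-- body means a replication, and the names already received are restrictions extruded to the top
-- (`nuAll`). `Simulation` relates a ρ-process to a π-process through such a multiset of components,
-- together with a natural number, its weight.
--
-- A ρ-reduction is a communication between two components (`StepOn.comps`). All subjects are atomic
-- names, issued names, `v`, `x`, `z` or names with a path from `n`; the choice of parameters makes
-- these pairwise inequivalent (`Fresh.injective`), because the generating operations are injective
-- with disjoint images (`Op.apply_inj`). Only seven pairs of components can then communicate. Two
-- of them are π-communications. The other five are administrative: they keep the π-process up to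
-- structural congruence and decrease the weight (`Simulation.step`). So an infinite ρ-sequence
-- contains infinitely many π-steps, and administrative steps alone terminate.
--
-- Copies of a replicated body share their parameters, so answers and copiers may cross between
-- copies. This is harmless as long as an answer meets only waiting restrictions and a copier only
-- stored bodies: any unused issued name suits any restriction, and any stored body may be unfolded.
-- It suffices that each path serves only restrictions or only replications, which the function `K`
-- records. The weight decreases because an unfolding consumes a copier that only a later
-- π-communication restores, and because each new turn of the server loop is paid for by a request.

namespace RhoCalc

/-! ### Renaming and substitution -/

@[simp] theorem Name.up_subst {k m : ℕ} (x : Name 0) (σ : Sub k m) :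
    (x.up).subst σ = x.up := by
  cases x with
  | bound i => exact i.elim0
  | quote P => rfl

@[simp] theorem Name.up_substDrop {k m : ℕ} (x : Name 0) (σ : Sub k m) :
    (x.up).substDrop σ = .drop x.up := by
  cases x with
  | bound i => exact i.elim0
  | quote P => rfl

@[simp] theorem Name.up_zero (x : Name 0) : x.up (k := 0) = x := by
  cases x with
  | bound i => exact i.elim0
  | quote P => rfl

theorem liftRen_id {k : ℕ} : liftRen (id : Fin k → Fin k) = id := by
  funext i
  refine Fin.cases rfl (fun i => rfl) i

theorem Name.rename_id {k : ℕ} (x : Name k) : x.rename id = x := by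
  cases x <;> rfl

theorem Proc.rename_id : ∀ {k : ℕ} (P : Proc k), P.rename id = P
  | _, .nil => rfl
  | _, .par P Q => by simp only [Proc.rename, Proc.rename_id P, Proc.rename_id Q]
  | _, .lift x P => by simp only [Proc.rename, Proc.rename_id P, Name.rename_id]
  | _, .input x P => by simp only [Proc.rename, liftRen_id, Proc.rename_id P, Name.rename_id]
  | _, .drop x => by simp only [Proc.rename, Name.rename_id]

@[simp] theorem Proc.up_zero (P : Proc 0) : P.up (k := 0) = P := by
  rw [Proc.up, Subsingleton.elim (Fin.elim0 : Fin 0 → Fin 0) id, Proc.rename_id]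

/-- The effect of a substitution after a renaming. -/
theorem liftSub_liftRen {k m l : ℕ} (ρ : Fin k → Fin m) (σ : Sub m l) :
    liftSub σ ∘ liftRen ρ = liftSub (σ ∘ ρ) := by
  funext i
  refine Fin.cases rfl (fun i => rfl) i

theorem Name.rename_subst {k m l : ℕ} (ρ : Fin k → Fin m) (σ : Sub m l) (x : Name k) :
    (x.rename ρ).subst σ = x.subst (σ ∘ ρ) := by
  cases x <;> rfl

theorem Name.rename_substDrop {k m l : ℕ} (ρ : Fin k → Fin m) (σ : Sub m l) (x : Name k) :
    (x.rename ρ).substDrop σ = x.substDrop (σ ∘ ρ) := by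
  cases x <;> rfl

theorem Proc.rename_subst : ∀ {k m l : ℕ} (ρ : Fin k → Fin m) (σ : Sub m l) (P : Proc k),
    (P.rename ρ).subst σ = P.subst (σ ∘ ρ)
  | _, _, _, _, _, .nil => rfl
  | _, _, _, ρ, σ, .par P Q => by
      simp only [Proc.rename, Proc.subst, Proc.rename_subst ρ σ P, Proc.rename_subst ρ σ Q]
  | _, _, _, ρ, σ, .lift x P => by
      simp only [Proc.rename, Proc.subst, Proc.rename_subst ρ σ P, Name.rename_subst]
  | _, _, _, ρ, σ, .input x P => by
      simp only [Proc.rename, Proc.subst, Proc.rename_subst _ _ P, Name.rename_subst,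
        liftSub_liftRen]
  | _, _, _, ρ, σ, .drop x => by
      simp only [Proc.rename, Proc.subst, Name.rename_substDrop]

theorem Name.subst_inl {k m : ℕ} (ρ : Fin k → Fin m) (x : Name k) :
    x.subst (fun i => Sum.inl (ρ i)) = x.rename ρ := by
  cases x <;> rfl

theorem liftSub_inl {k m : ℕ} (ρ : Fin k → Fin m) :
    liftSub (fun i => Sum.inl (ρ i)) = fun i => Sum.inl (liftRen ρ i) := by
  funext i
  refine Fin.cases rfl (fun i => rfl) i

theorem Proc.subst_inl : ∀ {k m : ℕ} (ρ : Fin k → Fin m) (P : Proc k),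
    P.subst (fun i => Sum.inl (ρ i)) = P.rename ρ
  | _, _, _, .nil => rfl
  | _, _, ρ, .par P Q => by
      simp only [Proc.rename, Proc.subst, Proc.subst_inl ρ P, Proc.subst_inl ρ Q]
  | _, _, ρ, .lift x P => by
      simp only [Proc.rename, Proc.subst, Proc.subst_inl ρ P, Name.subst_inl]
  | _, _, ρ, .input x P => by
      simp only [Proc.rename, Proc.subst, liftSub_inl, Proc.subst_inl _ P, Name.subst_inl]
  | _, _, ρ, .drop x => by
      simp only [Proc.rename, Proc.subst]
      cases x <;> rfl

@[simp] theorem Proc.up_subst {k m : ℕ} (P : Proc 0) (σ : Sub k m) :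
    (P.up).subst σ = P.up := by
  rw [Proc.up, Proc.rename_subst, Proc.up, ← Proc.subst_inl]
  congr 1
  funext i
  exact i.elim0

theorem Proc.subst_zero (P : Proc 0) (σ : Sub 0 0) : P.subst σ = P := by
  simpa using Proc.up_subst (k := 0) P σ

/-- Composition of substitutions. -/
def Sub.comp {k m l : ℕ} (σ : Sub k m) (τ : Sub m l) : Sub k l :=
  fun i => Sum.elim τ Sum.inr (σ i)

theorem Name.subst_subst {k m l : ℕ} (σ : Sub k m) (τ : Sub m l) (x : Name k) :
    (x.subst σ).subst τ = x.subst (σ.comp τ) := by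
  cases x with
  | quote P => rfl
  | bound i =>
    simp only [Name.subst, Sub.comp]
    rcases σ i with j | Q <;> rfl

theorem Name.substDrop_subst {k m l : ℕ} (σ : Sub k m) (τ : Sub m l) (x : Name k) :
    (x.substDrop σ).subst τ = x.substDrop (σ.comp τ) := by
  cases x with
  | quote P => rfl
  | bound i =>
    simp only [Name.substDrop, Sub.comp]
    rcases σ i with j | Q
    · rfl
    · simp

theorem liftSub_comp {k m l : ℕ} (σ : Sub k m) (τ : Sub m l) :
    Sub.comp (liftSub σ) (liftSub τ) = liftSub (σ.comp τ) := by
  funext i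
  refine Fin.cases rfl (fun i => ?_) i
  simp only [Sub.comp, liftSub, Fin.cases_succ]
  rcases σ i with j | Q <;> rfl

theorem Proc.subst_subst : ∀ {k m l : ℕ} (σ : Sub k m) (τ : Sub m l) (P : Proc k),
    (P.subst σ).subst τ = P.subst (σ.comp τ)
  | _, _, _, _, _, .nil => rfl
  | _, _, _, ρ, σ, .par P Q => by
      simp only [Proc.subst, Proc.subst_subst ρ σ P, Proc.subst_subst ρ σ Q]
  | _, _, _, ρ, σ, .lift x P => by
      simp only [Proc.subst, Proc.subst_subst ρ σ P, Name.subst_subst]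
  | _, _, _, ρ, σ, .input x P => by
      simp only [Proc.subst, Proc.subst_subst _ _ P, Name.subst_subst, liftSub_comp]
  | _, _, _, ρ, σ, .drop x => by
      simp only [Proc.subst, Name.substDrop_subst]

theorem Proc.subst_liftSub_inst {k : ℕ} (P : Proc (k + 1)) (e : Fin k → Proc 0) (Q : Proc 0) :
    (P.subst (liftSub fun i => Sum.inr (e i))).inst Q =
      P.subst (Fin.cases (Sum.inr Q) fun i => Sum.inr (e i)) := by
  rw [Proc.inst, Proc.subst_subst]
  congr 1
  funext i
  refine Fin.cases rfl (fun i => rfl) i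

/-! ### Congruence and substitution -/

theorem Name.Equiv.rename {k m : ℕ} (ρ : Fin k → Fin m) {x y : Name k} (h : Name.Equiv x y) :
    Name.Equiv (x.rename ρ) (y.rename ρ) :=
  match h with
  | .refl _ => .refl _
  | .symm h => (Name.Equiv.rename ρ h).symm
  | .trans h₁ h₂ => (Name.Equiv.rename ρ h₁).trans (Name.Equiv.rename ρ h₂)
  | .struct h => .struct h
  | .drop h => .drop h

theorem Proc.Cong.rename {k m : ℕ} (ρ : Fin k → Fin m) {P Q : Proc k} (h : Proc.Cong P Q) :
    Proc.Cong (P.rename ρ) (Q.rename ρ) :=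
  match h with
  | .refl _ => .refl _
  | .symm h => (Proc.Cong.rename ρ h).symm
  | .trans h₁ h₂ => (Proc.Cong.rename ρ h₁).trans (Proc.Cong.rename ρ h₂)
  | .par_nil _ => .par_nil _
  | .par_comm _ _ => .par_comm _ _
  | .par_assoc _ _ _ => .par_assoc _ _ _
  | .par h₁ h₂ => .par (Proc.Cong.rename ρ h₁) (Proc.Cong.rename ρ h₂)
  | .lift h₁ h₂ => .lift (h₁.rename ρ) (Proc.Cong.rename ρ h₂)
  | .input h₁ h₂ => .input (h₁.rename ρ) (Proc.Cong.rename (liftRen ρ) h₂)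
  | .drop h => .drop (h.rename ρ)

theorem Name.Equiv.subst {k m : ℕ} (σ : Sub k m) {x y : Name k} (h : Name.Equiv x y) :
    Name.Equiv (x.subst σ) (y.subst σ) ∧ Proc.Cong (x.substDrop σ) (y.substDrop σ) :=
  match h with
  | .refl _ => ⟨.refl _, .refl _⟩
  | .symm h => ⟨(Name.Equiv.subst σ h).1.symm, (Name.Equiv.subst σ h).2.symm⟩
  | .trans h₁ h₂ => ⟨(Name.Equiv.subst σ h₁).1.trans (Name.Equiv.subst σ h₂).1,
      (Name.Equiv.subst σ h₁).2.trans (Name.Equiv.subst σ h₂).2⟩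
  | .struct h => ⟨.struct h, .drop (.struct h)⟩
  | .drop h => ⟨.drop h, .drop (.drop h)⟩

theorem Proc.Cong.subst {k m : ℕ} (σ : Sub k m) {P Q : Proc k} (h : Proc.Cong P Q) :
    Proc.Cong (P.subst σ) (Q.subst σ) :=
  match h with
  | .refl _ => .refl _
  | .symm h => (Proc.Cong.subst σ h).symm
  | .trans h₁ h₂ => (Proc.Cong.subst σ h₁).trans (Proc.Cong.subst σ h₂)
  | .par_nil _ => .par_nil _
  | .par_comm _ _ => .par_comm _ _
  | .par_assoc _ _ _ => .par_assoc _ _ _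
  | .par h₁ h₂ => .par (Proc.Cong.subst σ h₁) (Proc.Cong.subst σ h₂)
  | .lift h₁ h₂ => .lift (h₁.subst σ).1 (Proc.Cong.subst σ h₂)
  | .input h₁ h₂ => .input (h₁.subst σ).1 (Proc.Cong.subst (liftSub σ) h₂)
  | .drop h => (h.subst σ).2

/-- Structural congruence of substitutions. -/
inductive SubCong {m : ℕ} : Fin m ⊕ Proc 0 → Fin m ⊕ Proc 0 → Prop
  | inl (i : Fin m) : SubCong (.inl i) (.inl i)
  | inr {P Q : Proc 0} : Proc.Cong P Q → SubCong (.inr P) (.inr Q)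

theorem SubCong.liftSub {k m : ℕ} {σ τ : Sub k m} (h : ∀ i, SubCong (σ i) (τ i)) (i : Fin (k + 1)) :
    SubCong (RhoCalc.liftSub σ i) (RhoCalc.liftSub τ i) := by
  refine Fin.cases (.inl _) (fun i => ?_) i
  simp only [RhoCalc.liftSub, Fin.cases_succ]
  have := h i
  revert this
  generalize σ i = a
  generalize τ i = b
  rintro (j | h)
  · exact .inl _
  · exact .inr h

theorem Name.subst_congr {k m : ℕ} {σ τ : Sub k m} (h : ∀ i, SubCong (σ i) (τ i)) (x : Name k) :
    Name.Equiv (x.subst σ) (x.subst τ) ∧ Proc.Cong (x.substDrop σ) (x.substDrop τ) := by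
  cases x with
  | quote P => exact ⟨.refl _, .refl _⟩
  | bound i =>
    simp only [Name.subst, Name.substDrop]
    have := h i
    revert this
    generalize σ i = a
    generalize τ i = b
    rintro (j | h)
    · exact ⟨.refl _, .refl _⟩
    · exact ⟨.struct h, h.rename _⟩

theorem Proc.subst_congr : ∀ {k m : ℕ} {σ τ : Sub k m} (_ : ∀ i, SubCong (σ i) (τ i)) (P : Proc k),
    Proc.Cong (P.subst σ) (P.subst τ)
  | _, _, _, _, _, .nil => .refl _
  | _, _, _, _, h, .par P Q => .par (Proc.subst_congr h P) (Proc.subst_congr h Q)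
  | _, _, _, _, h, .lift x P => .lift (Name.subst_congr h x).1 (Proc.subst_congr h P)
  | _, _, _, _, h, .input x P =>
      .input (Name.subst_congr h x).1 (Proc.subst_congr (SubCong.liftSub h) P)
  | _, _, _, _, h, .drop x => (Name.subst_congr h x).2

theorem Proc.Cong.inst {P P' : Proc 1} {Q Q' : Proc 0} (hP : Proc.Cong P P') (hQ : Proc.Cong Q Q') :
    Proc.Cong (P.inst Q) (P'.inst Q') :=
  (hP.subst _).trans (Proc.subst_congr (fun _ => .inr hQ) P')

/-! ### Components -/

/-- The multiset of the parallel components of a process. -/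
def Proc.comps : {k : ℕ} → Proc k → Multiset (Proc k)
  | _, .nil => 0
  | _, .par P Q => P.comps + Q.comps
  | _, .lift x P => {.lift x P}
  | _, .input x P => {.input x P}
  | _, .drop x => {.drop x}

/-- Congruence of lifts, inputs and drops by congruence of their parts. -/
inductive Proc.PrimeCong : {k : ℕ} → Proc k → Proc k → Prop
  | lift {k : ℕ} {x₁ x₂ : Name k} {P₁ P₂ : Proc k} :
      Name.Equiv x₁ x₂ → Proc.Cong P₁ P₂ → Proc.PrimeCong (.lift x₁ P₁) (.lift x₂ P₂)
  | input {k : ℕ} {x₁ x₂ : Name k} {P₁ P₂ : Proc (k + 1)} :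
      Name.Equiv x₁ x₂ → Proc.Cong P₁ P₂ → Proc.PrimeCong (.input x₁ P₁) (.input x₂ P₂)
  | drop {k : ℕ} {x₁ x₂ : Name k} :
      Name.Equiv x₁ x₂ → Proc.PrimeCong (.drop x₁) (.drop x₂)

theorem Proc.PrimeCong.symm {k : ℕ} {P Q : Proc k} (h : Proc.PrimeCong P Q) :
    Proc.PrimeCong Q P := by
  cases h with
  | lift h₁ h₂ => exact .lift h₁.symm h₂.symm
  | input h₁ h₂ => exact .input h₁.symm h₂.symm
  | drop h => exact .drop h.symm

theorem Proc.PrimeCong.trans {k : ℕ} {P Q R : Proc k} (h : Proc.PrimeCong P Q)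
    (h' : Proc.PrimeCong Q R) : Proc.PrimeCong P R := by
  cases h with
  | lift h₁ h₂ => cases h' with
    | lift h₃ h₄ => exact .lift (h₁.trans h₃) (h₂.trans h₄)
  | input h₁ h₂ => cases h' with
    | input h₃ h₄ => exact .input (h₁.trans h₃) (h₂.trans h₄)
  | drop h => cases h' with
    | drop h' => exact .drop (h.trans h')

/-- Componentwise congruence. -/
abbrev CompsCong {k : ℕ} : Multiset (Proc k) → Multiset (Proc k) → Prop :=
  Multiset.Rel Proc.PrimeCong

theorem CompsCong.symm {k : ℕ} {M N : Multiset (Proc k)} (h : CompsCong M N) : CompsCong N M := by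
  have := Multiset.rel_flip.2 h
  exact this.mono fun _ _ _ _ h => h.symm

theorem CompsCong.trans {k : ℕ} {M N L : Multiset (Proc k)} (h : CompsCong M N)
    (h' : CompsCong N L) : CompsCong M L := by
  have : IsTrans (Proc k) Proc.PrimeCong := ⟨fun _ _ _ h h' => h.trans h'⟩
  exact Multiset.Rel.trans _ h h'

theorem CompsCong.singleton {k : ℕ} {P Q : Proc k} (h : Proc.PrimeCong P Q) :
    CompsCong {P} {Q} :=
  Multiset.Rel.cons h .zero

theorem Proc.comps_refl : ∀ {k : ℕ} (P : Proc k), CompsCong P.comps P.comps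
  | _, .nil => .zero
  | _, .par P Q => Multiset.Rel.add (Proc.comps_refl P) (Proc.comps_refl Q)
  | _, .lift _ _ => CompsCong.singleton (.lift (.refl _) (.refl _))
  | _, .input _ _ => CompsCong.singleton (.input (.refl _) (.refl _))
  | _, .drop _ => CompsCong.singleton (.drop (.refl _))

/-- The monoid laws leave the multiset of components equal, and the remaining congruence rules act
inside single components. Structural congruence at top level can therefore be analysed on multisets.
-/
theorem Proc.Cong.comps {k : ℕ} {P Q : Proc k} (h : Proc.Cong P Q) :
    CompsCong P.comps Q.comps :=
  match h with
  | .refl _ => Proc.comps_refl _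
  | .symm h => CompsCong.symm (Proc.Cong.comps h)
  | .trans h₁ h₂ => CompsCong.trans (Proc.Cong.comps h₁) (Proc.Cong.comps h₂)
  | .par_nil P => by simpa [Proc.comps] using Proc.comps_refl P
  | .par_comm P Q => by
      simpa [Proc.comps, add_comm] using Proc.comps_refl (.par P Q)
  | .par_assoc P Q R => by
      simpa [Proc.comps, add_assoc] using Proc.comps_refl (.par P (.par Q R))
  | .par h₁ h₂ => Multiset.Rel.add (Proc.Cong.comps h₁) (Proc.Cong.comps h₂)
  | .lift h₁ h₂ => CompsCong.singleton (.lift h₁ h₂)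
  | .input h₁ h₂ => CompsCong.singleton (.input h₁ h₂)
  | .drop h => CompsCong.singleton (.drop h)

/-- A reduction is a communication between two of the components. -/
theorem StepOn.comps {A : Set (Name 0)} {T T' : Proc 0} (h : StepOn A T T') :
    ∀ M, CompsCong T.comps M → ∃ c ∈ A, ∃ x₁ x₂ P₁ P₂ R,
      M = .input x₁ P₁ ::ₘ .lift x₂ P₂ ::ₘ R ∧ Name.Equiv c x₁ ∧ Name.Equiv x₁ x₂ ∧
      CompsCong T'.comps ((P₁.inst P₂).comps + R) := by
  -- `M` stays arbitrary: the closure of reduction under congruence replaces the components by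
  -- congruent ones.
  induction h with
  | @com x₁ x₂ P₁ P₂ hx hA =>
    intro M hM
    simp only [Proc.comps, Multiset.singleton_add] at hM
    obtain ⟨a, M', ha, hM', rfl⟩ := Multiset.rel_cons_left.1 hM
    rw [← Multiset.cons_zero] at hM'
    obtain ⟨b, M'', hb, hM'', rfl⟩ := Multiset.rel_cons_left.1 hM'
    rw [Multiset.rel_zero_left] at hM''
    subst hM''
    cases ha with
    | input h₁ h₂ => cases hb with
      | lift h₃ h₄ =>
        refine ⟨_, hA, _, _, _, _, 0, rfl, h₁, (h₁.symm.trans hx).trans h₃, ?_⟩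
        simpa using (h₂.inst h₄).comps
  | par P₂ h ih =>
    intro M hM
    obtain ⟨M₁, M₂, h₁, h₂, rfl⟩ := Multiset.rel_add_left.1 hM
    obtain ⟨c, hc, x₁, x₂, P, Q, R, rfl, h₃, h₄, h₅⟩ := ih M₁ h₁
    refine ⟨c, hc, x₁, x₂, P, Q, R + M₂, by simp, h₃, h₄, ?_⟩
    rw [← add_assoc]
    exact h₅.add h₂
  | struct h₁ h h₂ ih =>
    intro M hM
    obtain ⟨c, hc, x₁, x₂, P, Q, R, rfl, h₃, h₄, h₅⟩ := ih M (h₁.symm.comps.trans hM)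
    exact ⟨c, hc, x₁, x₂, P, Q, R, rfl, h₃, h₄, h₂.symm.comps.trans h₅⟩

theorem Step.stepOn_univ {T T' : Proc 0} (h : Step T T') : StepOn Set.univ T T' := by
  induction h with
  | com P Q h => exact .com P Q h trivial
  | par P h ih => exact .par P ih
  | struct h₁ h h₂ ih => exact .struct h₁ ih h₂

/-! ### Inversion of name equivalence -/

mutual
/-- If the process is a drop up to structural congruence, the process in the innermost quote. -/
noncomputable def Proc.core : {k : ℕ} → Proc k → Option (Proc 0)
  | _, .nil => none
  | _, .par P Q => open Classical in
      if Q.comps = 0 then P.core else if P.comps = 0 then Q.core else none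
  | _, .lift _ _ => none
  | _, .input _ _ => none
  | _, .drop x => x.core
/-- The process quoted by a name, after the removal of all drops of quotes. -/
noncomputable def Name.core : {k : ℕ} → Name k → Option (Proc 0)
  | _, .bound _ => none
  | _, .quote P => some (P.core.getD P)
end

/-- The quoted processes agree up to structural congruence. -/
abbrev CoreCong : Option (Proc 0) → Option (Proc 0) → Prop := Option.Rel Proc.Cong

theorem CoreCong.refl : ∀ a, CoreCong a a
  | none => .none
  | some P => .some (.refl P)

theorem CoreCong.symm {a b : Option (Proc 0)} (h : CoreCong a b) : CoreCong b a := by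
  cases h with
  | none => exact .none
  | some h => exact .some h.symm

theorem CoreCong.trans {a b c : Option (Proc 0)} (h : CoreCong a b) (h' : CoreCong b c) :
    CoreCong a c := by
  cases h with
  | none => exact h'
  | some h => cases h' with
    | some h' => exact .some (h.trans h')

theorem Proc.core_of_comps_eq_zero : ∀ {k : ℕ} (P : Proc k), P.comps = 0 → P.core = none
  | _, .nil, _ => by simp [Proc.core]
  | _, .par P Q, h => by
      simp only [Proc.comps, add_eq_zero] at h
      simp [Proc.core, h.2, Proc.core_of_comps_eq_zero P h.1]
  | _, .lift x P, h => by simp [Proc.core]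
  | _, .input x P, h => by simp [Proc.core]
  | _, .drop x, h => by simp [Proc.comps] at h

theorem CompsCong.eq_zero_iff {k : ℕ} {M N : Multiset (Proc k)} (h : CompsCong M N) :
    M = 0 ↔ N = 0 := by
  rw [← Multiset.card_eq_zero, ← Multiset.card_eq_zero, Multiset.card_eq_card_of_rel h]

theorem CoreCong.some_getD {P Q : Proc 0} (h : Proc.Cong P Q) (hc : CoreCong P.core Q.core) :
    CoreCong (some (P.core.getD P)) (some (Q.core.getD Q)) := by
  revert hc
  generalize P.core = a
  generalize Q.core = b
  rintro (h' | _)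
  · exact .some h'
  · exact .some h

mutual
-- Name equivalence is generated with transitivity, so it cannot be inverted by cases. The core is
-- an invariant, up to congruence, that computes away the only non-structural rule, the one for the
-- quote of a drop.
theorem Proc.Cong.core {k : ℕ} {P Q : Proc k} (h : Proc.Cong P Q) : CoreCong P.core Q.core :=
  match h with
  | .refl _ => CoreCong.refl _
  | .symm h => CoreCong.symm (Proc.Cong.core h)
  | .trans h₁ h₂ => CoreCong.trans (Proc.Cong.core h₁) (Proc.Cong.core h₂)
  | .par_nil P => by simpa [Proc.core, Proc.comps] using CoreCong.refl _
  | .par_comm P Q => by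
      simp only [Proc.core]
      split_ifs with h₁ h₂ h₂
      · rw [P.core_of_comps_eq_zero h₂, Q.core_of_comps_eq_zero h₁]; exact .none
      · exact CoreCong.refl _
      · exact CoreCong.refl _
      · exact .none
  | .par_assoc P Q R => by
      simp only [Proc.core, Proc.comps, add_eq_zero]
      by_cases h₁ : P.comps = 0 <;> by_cases h₂ : Q.comps = 0 <;> by_cases h₃ : R.comps = 0 <;>
        simp [h₁, h₂, h₃, CoreCong.refl, Proc.core_of_comps_eq_zero]
  | .par h₁ h₂ => by
      have e₁ := h₁.comps.eq_zero_iff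
      have e₂ := h₂.comps.eq_zero_iff
      simp only [Proc.core]
      split_ifs <;> first | exact Proc.Cong.core h₁ | exact Proc.Cong.core h₂ | exact .none | tauto
  | .lift _ _ => by simp only [Proc.core]; exact .none
  | .input _ _ => by simp only [Proc.core]; exact .none
  | .drop h => by simp only [Proc.core]; exact Name.Equiv.core h
theorem Name.Equiv.core {k : ℕ} {x y : Name k} (h : Name.Equiv x y) : CoreCong x.core y.core :=
  match h with
  | .refl _ => CoreCong.refl _
  | .symm h => CoreCong.symm (Name.Equiv.core h)
  | .trans h₁ h₂ => CoreCong.trans (Name.Equiv.core h₁) (Name.Equiv.core h₂)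
  | .struct h => by simp only [Name.core]; exact CoreCong.some_getD h (Proc.Cong.core h)
  | .drop h => by
      have := Name.Equiv.core h
      simp only [Name.core, Proc.core] at this ⊢
      -- A quote always has a core, hence so does the equivalent name under the drop, and the drop
      -- passes it on.
      cases hx : Name.core _ with
      | none => rw [hx] at this; cases this
      | some A => rw [hx] at this; simpa using this
end

/-- Quoted processes that are no drops are determined by the name up to structural congruence. -/
theorem Name.Equiv.cong_of_core {P Q : Proc 0} (h : Name.Equiv (k := 0) (.quote P) (.quote Q))
    (hP : P.core = none) (hQ : Q.core = none) : Proc.Cong P Q := by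
  have := h.core
  simp only [Name.core, hP, hQ, Option.getD_none] at this
  cases this with
  | some h => exact h

-- Nesting depth, an invariant of name equivalence

mutual
/-- The nesting depth of subjects in names. -/
def Proc.depth : {k : ℕ} → Proc k → ℕ
  | _, .nil => 0
  | _, .par P Q => max P.depth Q.depth
  | _, .lift x P => max (x.depth + 1) P.depth
  | _, .input x P => max (x.depth + 1) P.depth
  | _, .drop x => x.depth
def Name.depth : {k : ℕ} → Name k → ℕ
  | _, .bound _ => 0
  | _, .quote P => P.depth
end

mutual
-- The quote of a drop is equivalent to the dropped name; this is why a drop adds no level, whereas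
-- the subject of a lift or an input does.
theorem Proc.Cong.depth {k : ℕ} {P Q : Proc k} (h : Proc.Cong P Q) : P.depth = Q.depth :=
  match h with
  | .refl _ => rfl
  | .symm h => (Proc.Cong.depth h).symm
  | .trans h₁ h₂ => (Proc.Cong.depth h₁).trans (Proc.Cong.depth h₂)
  | .par_nil P => by simp [Proc.depth]
  | .par_comm P Q => by simp only [Proc.depth, max_comm]
  | .par_assoc P Q R => by simp only [Proc.depth, max_assoc]
  | .par h₁ h₂ => by simp only [Proc.depth, Proc.Cong.depth h₁, Proc.Cong.depth h₂]
  | .lift h₁ h₂ => by simp only [Proc.depth, Name.Equiv.depth h₁, Proc.Cong.depth h₂]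
  | .input h₁ h₂ => by simp only [Proc.depth, Name.Equiv.depth h₁, Proc.Cong.depth h₂]
  | .drop h => by simp only [Proc.depth, Name.Equiv.depth h]
theorem Name.Equiv.depth {k : ℕ} {x y : Name k} (h : Name.Equiv x y) : x.depth = y.depth :=
  match h with
  | .refl _ => rfl
  | .symm h => (Name.Equiv.depth h).symm
  | .trans h₁ h₂ => (Name.Equiv.depth h₁).trans (Name.Equiv.depth h₂)
  | .struct h => by simp only [Name.depth, Proc.Cong.depth h]
  | .drop h => by
      have := Name.Equiv.depth h
      simp only [Name.depth, Proc.depth] at this ⊢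
      exact this
end

theorem Name.quote_drop_equiv {k : ℕ} (x : Name 0) :
    Name.Equiv (k := k) (.quote (.drop x)) x.up := by
  cases x with
  | bound i => exact i.elim0
  | quote P => exact .drop (.refl _)

end RhoCalc

/-! ## Restriction and parallel composition of many processes -/

namespace PiCalc

variable {𝒩 : Type*}

/-- The restriction of all names in scope. -/
def nuAll : (k : ℕ) → Proc 𝒩 k → Proc 𝒩 0
  | 0, P => P
  | k + 1, P => nuAll k (.nu P)

theorem Proc.Cong.nuAll : ∀ {k : ℕ} {P Q : Proc 𝒩 k}, P.Cong Q → (nuAll k P).Cong (nuAll k Q)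
  | 0, _, _, h => h
  | k + 1, _, _, h => Proc.Cong.nuAll (k := k) h.nu

theorem Step.nuAll : ∀ {k : ℕ} {P Q : Proc 𝒩 k}, Step P Q → Step (nuAll k P) (nuAll k Q)
  | 0, _, _, h => h
  | k + 1, _, _, h => Step.nuAll (k := k) h.res

theorem Proc.Cong.par_left_comm {k : ℕ} (P Q R : Proc 𝒩 k) :
    Proc.Cong (.par P (.par Q R)) (.par Q (.par P R)) :=
  (Proc.Cong.par_assoc P Q R).symm.trans
    ((Proc.Cong.par (.par_comm P Q) (.refl R)).trans (.par_assoc Q P R))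

/-- The parallel composition of a list of processes. -/
def parList {k : ℕ} : List (Proc 𝒩 k) → Proc 𝒩 k
  | [] => .nil
  | P :: l => .par P (parList l)

theorem parList_perm {k : ℕ} {l l' : List (Proc 𝒩 k)} (h : l.Perm l') :
    (parList l).Cong (parList l') := by
  induction h with
  | nil => exact .refl _
  | cons P _ ih => exact .par (.refl P) ih
  | swap P Q l => exact .par_left_comm _ _ _
  | trans _ _ ih₁ ih₂ => exact ih₁.trans ih₂

/-- The parallel composition of a multiset of processes. -/
noncomputable def parAll {k : ℕ} (M : Multiset (Proc 𝒩 k)) : Proc 𝒩 k := parList M.toList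

theorem parAll_coe {k : ℕ} (l : List (Proc 𝒩 k)) :
    (parAll (l : Multiset (Proc 𝒩 k))).Cong (parList l) :=
  parList_perm (Multiset.coe_eq_coe.1 (Multiset.coe_toList _))

theorem parAll_cons {k : ℕ} (P : Proc 𝒩 k) (M : Multiset (Proc 𝒩 k)) :
    (parAll (P ::ₘ M)).Cong (.par P (parAll M)) := by
  conv_lhs => rw [← M.coe_toList, Multiset.cons_coe]
  exact parAll_coe _

theorem parAll_zero {k : ℕ} : (parAll (0 : Multiset (Proc 𝒩 k))).Cong .nil := parAll_coe []

theorem parAll_singleton {k : ℕ} (P : Proc 𝒩 k) : (parAll {P}).Cong P :=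
  (parAll_cons P 0).trans ((Proc.Cong.par (.refl P) parAll_zero).trans (.par_nil P))

theorem Proc.Cong.nil_par {k : ℕ} (P : Proc 𝒩 k) : Proc.Cong (.par .nil P) P :=
  (Proc.Cong.par_comm _ _).trans (.par_nil P)

theorem parAll_add {k : ℕ} (M N : Multiset (Proc 𝒩 k)) :
    (parAll (M + N)).Cong (.par (parAll M) (parAll N)) := by
  induction M using Multiset.induction with
  | empty =>
    rw [zero_add]
    exact ((Proc.Cong.par parAll_zero (.refl _)).trans (.nil_par _)).symm
  | cons P M ih =>
    rw [Multiset.cons_add]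
    exact (parAll_cons _ _).trans ((Proc.Cong.par (.refl P) ih).trans
      ((Proc.Cong.par_assoc _ _ _).symm.trans (.par (parAll_cons _ _).symm (.refl _))))

theorem parAll_map_weaken {k : ℕ} (M : Multiset (Proc 𝒩 k)) :
    (parAll (M.map Proc.weaken)).Cong (parAll M).weaken := by
  have key : ∀ l : List (Proc 𝒩 k), parList (l.map Proc.weaken) = (parList l).weaken := by
    intro l
    induction l with
    | nil => rfl
    | cons P l ih => simp only [List.map_cons, parList, ih]; rfl
  rw [parAll, parAll, ← key]
  refine parList_perm (Multiset.coe_eq_coe.1 ?_)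
  rw [Multiset.coe_toList, ← Multiset.map_coe, Multiset.coe_toList]

end PiCalc

-- Names generated from a root: injectivity and disjointness

namespace RhoCalc

/-- The operations that generate the parameters of the encoding. -/
inductive Op
  | left | right | dup

/-- The effect of an operation on a name. -/
def Op.apply : Op → Name 0 → Name 0
  | .left, x => leftIncr x
  | .right, x => rightIncr x
  | .dup, x => compose x x

/-- The name generated from `n` by a list of operations, of which the first is applied last. -/
def pathName (n : Name 0) : List Op → Name 0
  | [] => n
  | o :: l => o.apply (pathName n l)

theorem Op.depth_apply (o : Op) (x : Name 0) : (o.apply x).depth = x.depth + 1 := by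
  cases o <;> simp [Op.apply, leftIncr, rightIncr, compose, Name.depth, Proc.depth]

theorem CompsCong.of_singleton {k : ℕ} {P Q : Proc k} (h : CompsCong {P} {Q}) :
    Proc.PrimeCong P Q := by
  obtain ⟨b, M, hb, hM, he⟩ := Multiset.rel_cons_left.1 (show CompsCong (P ::ₘ 0) {Q} from h)
  rw [Multiset.rel_zero_left] at hM
  subst hM
  rw [Multiset.cons_zero, Multiset.singleton_inj] at he
  rwa [he]

/-- None of the quoted processes is a drop, so equivalence of the names is congruence of the
processes. Their components, a lift, an input or one of each, reveal the operation, and the subjects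
reveal its argument. -/
theorem Op.apply_inj {o o' : Op} {x y : Name 0} (h : Name.Equiv (o.apply x) (o'.apply y)) :
    o = o' ∧ Name.Equiv x y := by
  have key : ∀ o x, ∃ P : Proc 0, Op.apply o x = .quote P ∧ P.core = none := by
    intro o x
    cases o <;> exact ⟨_, rfl, by simp [Proc.core, Proc.comps]⟩
  have hc : ∀ P Q : Proc 0, Op.apply o x = .quote P → Op.apply o' y = .quote Q →
      CompsCong P.comps Q.comps := by
    intro P Q hP hQ
    obtain ⟨P', hP', hP''⟩ := key o x
    obtain ⟨Q', hQ', hQ''⟩ := key o' y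
    rw [hP'] at hP
    rw [hQ'] at hQ
    cases hP
    cases hQ
    rw [hP', hQ'] at h
    exact (h.cong_of_core hP'' hQ'').comps
  cases o <;> cases o' <;> have hc := hc _ _ rfl rfl <;> simp only [Proc.comps] at hc
  · cases hc.of_singleton with
    | lift h _ => exact ⟨rfl, h⟩
  · cases hc.of_singleton
  · simpa using Multiset.card_eq_card_of_rel hc
  · cases hc.of_singleton
  · cases hc.of_singleton with
    | input h _ => exact ⟨rfl, h⟩
  · simpa using Multiset.card_eq_card_of_rel hc
  · simpa using Multiset.card_eq_card_of_rel hc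
  · simpa using Multiset.card_eq_card_of_rel hc
  · rw [Multiset.singleton_add, Multiset.singleton_add] at hc
    obtain ⟨b, M, hb, hM, he⟩ := Multiset.rel_cons_left.1 hc
    cases hb with
    | lift h₁ _ =>
      rcases Multiset.cons_eq_cons.1 he with ⟨h₂, _⟩ | ⟨_, M', h₂, _⟩
      · cases h₂
        exact ⟨rfl, h₁⟩
      · have : (Proc.lift _ _ : Proc 0) ∈ ({Proc.input y Proc.nil} : Multiset (Proc 0)) :=
          h₂ ▸ Multiset.mem_cons_self _ _
        simp at this

theorem depth_pathName (n : Name 0) (l : List Op) :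
    (pathName n l).depth = n.depth + l.length := by
  induction l with
  | nil => rfl
  | cons o l ih => rw [pathName, Op.depth_apply, ih]; rfl

/-- Equal operations are stripped one by one. Since each adds one to the depth, the root is not
equivalent to a name with a nonempty path, whatever `n` is. -/
theorem pathName_inj {n : Name 0} : ∀ {l l' : List Op},
    Name.Equiv (pathName n l) (pathName n l') → l = l'
  | [], [], _ => rfl
  | [], o :: l, h => by
      have := h.depth
      rw [depth_pathName, depth_pathName] at this
      simp at this
  | o :: l, [], h => by
      have := h.depth
      rw [depth_pathName, depth_pathName] at this
      simp at this
  | o :: l, o' :: l', h => by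
      have h' := Op.apply_inj h
      rw [h'.1, pathName_inj (l := l) (l' := l') h'.2]

theorem generated_pathName (n : Name 0) : ∀ l, Generated n (pathName n l)
  | [] => .root
  | .left :: l => .left (generated_pathName n l)
  | .right :: l => .right (generated_pathName n l)
  | .dup :: l => .compose (generated_pathName n l)

theorem Generated.exists_pathName {n m : Name 0} (h : Generated n m) :
    ∃ l, m = pathName n l := by
  induction h with
  | root => exact ⟨[], rfl⟩
  | left _ ih => obtain ⟨l, rfl⟩ := ih; exact ⟨.left :: l, rfl⟩
  | right _ ih => obtain ⟨l, rfl⟩ := ih; exact ⟨.right :: l, rfl⟩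
  | compose _ ih => obtain ⟨l, rfl⟩ := ih; exact ⟨.dup :: l, rfl⟩

theorem mem_namespaceOf {n m : Name 0} :
    m ∈ namespaceOf n ↔ ∃ l, Name.Equiv m (pathName n l) := by
  constructor
  · rintro ⟨m', h, hm⟩
    obtain ⟨l, rfl⟩ := h.exists_pathName
    exact ⟨l, hm⟩
  · rintro ⟨l, h⟩
    exact ⟨_, generated_pathName n l, h⟩

/-- The process that stands for the `i`-th name issued by the server: its quote is that name. -/
def issued (s : Name 0) : ℕ → Proc 0
  | 0 => .drop s
  | i + 1 => .lift (.quote (issued s i)) .nil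

theorem quote_issued_equiv (s : Name 0) : ∀ i,
    Name.Equiv (k := 0) (.quote (issued s i)) (pathName s (List.replicate i .left))
  | 0 => by simpa [issued, pathName] using Name.quote_drop_equiv (k := 0) s
  | i + 1 => .struct (.lift (quote_issued_equiv s i) (.refl _))

theorem pathName_replicate_left (s : Name 0) (i : ℕ) :
    pathName s (List.replicate i .left) = leftIncr^[i] s := by
  induction i with
  | zero => rfl
  | succ i ih => rw [Function.iterate_succ_apply', ← ih]; rfl

theorem mem_leftNamespace {s m : Name 0} {i : ℕ}
    (h : Name.Equiv m (pathName s (List.replicate i .left))) : m ∈ leftNamespace s :=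
  ⟨i, by rwa [← pathName_replicate_left]⟩

/-- Stripping operations on both sides ends at one of the roots, which puts `s` in the namespace of
`n` or `n` among the left increments of `s`. -/
theorem pathName_disjoint {n s : Name 0} (hn : n ∉ leftNamespace s) (hs : s ∉ namespaceOf n) :
    ∀ (i : ℕ) (l : List Op),
      ¬ Name.Equiv (pathName s (List.replicate i .left)) (pathName n l)
  | 0, l, h => hs (mem_namespaceOf.2 ⟨l, h⟩)
  | i + 1, [], h => hn (mem_leftNamespace (i := i + 1) h.symm)
  | i + 1, _ :: l, h => pathName_disjoint hn hs i l (Op.apply_inj h).2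

@[simp] theorem copier_subst {k m : ℕ} (x : Name 0) (σ : Sub k m) :
    (copier x).subst σ = copier x := by
  simp [copier, Proc.subst, Name.substDrop, liftSub]

theorem copier_inst (x : Name 0) (P : Proc 0) :
    Proc.inst (.par (.drop (.bound 0)) (.lift x.up (.drop (.bound 0)))) P =
      .par P (.lift x P) := by
  simp [Proc.inst, Proc.subst, Name.substDrop]

end RhoCalc

namespace PiToRho

open RhoCalc (Op Sub)

variable {𝒩 : Type*}

/-! ### Substitution in translated processes -/

/-- What is substituted for a pi-calculus name whose bound names are replaced by `σ`. -/
def nameSub (φ : 𝒩 → RhoCalc.Name 0) {m l : ℕ} (σ : Sub m l) :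
    PiCalc.Name 𝒩 m → Fin l ⊕ RhoCalc.Proc 0
  | .free a => .inr (.drop (φ a))
  | .bound i => σ i

theorem liftSub_nameSub (φ : 𝒩 → RhoCalc.Name 0) {k m l : ℕ} (τ : Fin k → PiCalc.Name 𝒩 m)
    (σ : Sub m l) :
    RhoCalc.liftSub (fun i => nameSub φ σ (τ i)) =
      fun i => nameSub φ (RhoCalc.liftSub σ) (PiCalc.liftSub τ i) := by
  funext i
  refine Fin.cases rfl (fun i => ?_) i
  simp only [RhoCalc.liftSub, PiCalc.liftSub, Fin.cases_succ]
  cases τ i <;> rfl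

/-- An atomic name that is received arrives as the quote of its drop, which is only equivalent to
the name; running it gives exactly the drop of the name. Hence an equivalence in one half and an
equality in the other. -/
theorem transName_subst (φ : 𝒩 → RhoCalc.Name 0) {k m l : ℕ} (τ : Fin k → PiCalc.Name 𝒩 m)
    (σ : Sub m l) (x : PiCalc.Name 𝒩 k) :
    RhoCalc.Name.Equiv ((transName φ (x.subst τ)).subst σ)
      ((transName φ x).subst fun i => nameSub φ σ (τ i)) ∧
    (transName φ (x.subst τ)).substDrop σ =
      (transName φ x).substDrop fun i => nameSub φ σ (τ i) := by
  cases x with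
  | free a => simp [PiCalc.Name.subst, transName, RhoCalc.Name.Equiv.refl]
  | bound i =>
    have key : ∀ y : PiCalc.Name 𝒩 m, RhoCalc.Name.Equiv ((transName φ y).subst σ)
        (RhoCalc.Name.subst (k := 1) (fun _ => nameSub φ σ y) (.bound 0)) ∧
        (transName φ y).substDrop σ =
          RhoCalc.Name.substDrop (k := 1) (fun _ => nameSub φ σ y) (.bound 0) := by
      rintro (a | j)
      · rw [transName, RhoCalc.Name.up_subst, RhoCalc.Name.up_substDrop]
        exact ⟨(RhoCalc.Name.quote_drop_equiv _).symm, rfl⟩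
      · exact ⟨.refl _, rfl⟩
    exact key (τ i)

theorem trans_subst (φ : 𝒩 → RhoCalc.Name 0) (v : RhoCalc.Name 0) :
    ∀ {k m l : ℕ} (τ : Fin k → PiCalc.Name 𝒩 m) (σ : Sub m l) (P : PiCalc.Proc 𝒩 k)
      (n : RhoCalc.Name 0),
      RhoCalc.Proc.Cong ((trans φ v (P.subst τ) n).subst σ)
        ((trans φ v P n).subst fun i => nameSub φ σ (τ i))
  | _, _, _, _, _, .nil, _ => .refl _
  | _, _, _, τ, σ, .par P Q, _ => .par (trans_subst φ v τ σ P _) (trans_subst φ v τ σ Q _)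
  | _, _, _, τ, σ, .input x P, n => by
      have := trans_subst φ v (PiCalc.liftSub τ) (RhoCalc.liftSub σ) P n
      rw [← liftSub_nameSub] at this
      exact .input (transName_subst φ τ σ x).1 this
  | _, _, _, τ, σ, .output x y, _ => by
      refine .lift (transName_subst φ τ σ x).1 ?_
      simp only [RhoCalc.Proc.subst]
      rw [(transName_subst φ τ σ y).2]
      exact .refl _
  | _, _, _, τ, σ, .nu P, n => by
      have := trans_subst φ v (PiCalc.liftSub τ) (RhoCalc.liftSub σ) P (RhoCalc.compose n n)
      rw [← liftSub_nameSub] at this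
      simp only [PiCalc.Proc.subst, trans, RhoCalc.Proc.subst, RhoCalc.output,
        RhoCalc.Name.up_subst, RhoCalc.Name.up_substDrop]
      exact .par (.refl _) (.input (.refl _) this)
  | _, _, _, τ, σ, .repl x P, n => by
      have := trans_subst φ v (PiCalc.liftSub τ) (RhoCalc.liftSub σ) P (RhoCalc.compose n n)
      rw [← liftSub_nameSub] at this
      simp only [PiCalc.Proc.subst, trans, RhoCalc.Proc.subst, RhoCalc.copier_subst,
        RhoCalc.Name.up_subst]
      exact .par (.refl _) (.lift (.refl _) (.input (transName_subst φ τ σ x).1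
        (.par (.refl _) this)))

end PiToRho

namespace PiToRho

open RhoCalc (Op Sub)

variable {𝒩 : Type*}

/-! ### Channels -/

/-- The parameters of the encoding. -/
structure Params (𝒩 : Type*) where
  φ : 𝒩 → RhoCalc.Name 0
  n : RhoCalc.Name 0
  v : RhoCalc.Name 0
  x : RhoCalc.Name 0
  z : RhoCalc.Name 0
  s : RhoCalc.Name 0

/-- The names on which the encoding communicates: atomic names, names issued by the server,
the parameters `v`, `x`, `z`, and the names derived from `n`. -/
inductive Chan (𝒩 : Type*)
  | atom (a : 𝒩)
  | issued (i : ℕ)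
  | v
  | x
  | z
  | path (l : List Op)

def Chan.name (p : Params 𝒩) : Chan 𝒩 → RhoCalc.Name 0
  | .atom a => p.φ a
  | .issued i => .quote (RhoCalc.issued p.s i)
  | .v => p.v
  | .x => p.x
  | .z => p.z
  | .path l => RhoCalc.pathName p.n l

/-- If the channel is an atomic name, then it is in `S`. -/
def Chan.OK (S : Set 𝒩) : Chan 𝒩 → Prop
  | .atom a => a ∈ S
  | _ => True

def Chan.Admin : Chan 𝒩 → Prop
  | .atom _ => False
  | .issued _ => False
  | _ => True

/-- The parameters are injective on channels. -/
def Params.Injective (p : Params 𝒩) (S : Set 𝒩) : Prop :=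
  ∀ c c' : Chan 𝒩, c.OK S → c'.OK S → RhoCalc.Name.Equiv (c.name p) (c'.name p) → c = c'

/-- All freshness hypotheses are used here and nowhere else. They concern only the free names of
`P`, so injectivity is restricted to channels whose atoms are among these. -/
theorem Fresh.injective {φ : 𝒩 → RhoCalc.Name 0} {P : PiCalc.Proc 𝒩 0}
    {n v x z s : RhoCalc.Name 0} (h : Fresh φ P n v x z s)
    (hφ : ∀ a b, RhoCalc.Name.Equiv (φ a) (φ b) → a = b) :
    Params.Injective ⟨φ, n, v, x, z, s⟩ P.freeNames := by
  have iss : ∀ {m : RhoCalc.Name 0} {i : ℕ},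
      RhoCalc.Name.Equiv m (.quote (RhoCalc.issued s i)) → m ∈ RhoCalc.leftNamespace s :=
    fun h => RhoCalc.mem_leftNamespace (h.trans (RhoCalc.quote_issued_equiv s _))
  have pth : ∀ {m : RhoCalc.Name 0} {l : List Op},
      RhoCalc.Name.Equiv m (RhoCalc.pathName n l) → m ∈ RhoCalc.namespaceOf n :=
    fun h => RhoCalc.mem_namespaceOf.2 ⟨_, h⟩
  have ip : ∀ {i : ℕ} {l : List Op},
      ¬ RhoCalc.Name.Equiv (.quote (RhoCalc.issued s i)) (RhoCalc.pathName n l) :=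
    fun {i l} h' => RhoCalc.pathName_disjoint h.n_server h.s_derived i l
      ((RhoCalc.quote_issued_equiv s i).symm.trans h')
  intro c c' hc hc' hcc
  cases c <;> cases c' <;> simp only [Chan.name, Chan.OK] at hc hc' hcc <;>
    first
    | rfl
    | exact congrArg _ (hφ _ _ hcc)
    | exact congrArg _ (RhoCalc.pathName_inj hcc)
    | exact (h.v_ne_x hcc).elim | exact (h.v_ne_x hcc.symm).elim
    | exact (h.v_ne_z hcc).elim | exact (h.v_ne_z hcc.symm).elim
    | exact (h.x_ne_z hcc).elim | exact (h.x_ne_z hcc.symm).elim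
    | exact (h.free_v _ hc hcc).elim | exact (h.free_v _ hc' hcc.symm).elim
    | exact (h.free_x _ hc hcc).elim | exact (h.free_x _ hc' hcc.symm).elim
    | exact (h.free_z _ hc hcc).elim | exact (h.free_z _ hc' hcc.symm).elim
    | exact (h.free_server _ hc (iss hcc)).elim | exact (h.free_server _ hc' (iss hcc.symm)).elim
    | exact (h.free_derived _ hc (pth hcc)).elim | exact (h.free_derived _ hc' (pth hcc.symm)).elim
    | exact (h.v_server (iss hcc)).elim | exact (h.v_server (iss hcc.symm)).elim
    | exact (h.x_server (iss hcc)).elim | exact (h.x_server (iss hcc.symm)).elim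
    | exact (h.z_server (iss hcc)).elim | exact (h.z_server (iss hcc.symm)).elim
    | exact (h.v_derived (pth hcc)).elim | exact (h.v_derived (pth hcc.symm)).elim
    | exact (h.x_derived (pth hcc)).elim | exact (h.x_derived (pth hcc.symm)).elim
    | exact (h.z_derived (pth hcc)).elim | exact (h.z_derived (pth hcc.symm)).elim
    | exact (ip hcc).elim | exact (ip hcc.symm).elim
    | skip
  -- The remaining case is that of two issued names: both are left increments of `s`, and the
  -- lengths of their paths are their indices.
  have := (((RhoCalc.quote_issued_equiv s _).symm.trans hcc).trans
    (RhoCalc.quote_issued_equiv s _))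
  have := congrArg List.length (RhoCalc.pathName_inj this)
  simp only [List.length_replicate] at this
  rw [this]

/-! ### Components of translated processes -/

/-- The components of the processes that are reachable from a translated process. -/
inductive Item (𝒩 : Type*) (k : ℕ)
  | inp (x : PiCalc.Name 𝒩 k) (P : PiCalc.Proc 𝒩 (k + 1)) (l : List Op)
  | out (x y : PiCalc.Name 𝒩 k)
  | request (l : List Op)
  | await (P : PiCalc.Proc 𝒩 (k + 1)) (l : List Op)
  | answer (l : List Op) (i : ℕ)
  | copier (l : List Op)
  | store (x : PiCalc.Name 𝒩 k) (P : PiCalc.Proc 𝒩 (k + 1)) (l : List Op)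
  | copy (x : PiCalc.Name 𝒩 k) (P : PiCalc.Proc 𝒩 (k + 1)) (l : List Op)
  | serverCopier
  | serverStore
  | serverReady
  | serverWait (i : ℕ)
  | serverNext (i : ℕ)

/-- The substitution of issued names for the bound names. -/
def envSub (p : Params 𝒩) {k : ℕ} (e : Fin k → ℕ) : Sub k 0 :=
  fun i => .inr (RhoCalc.issued p.s (e i))

/-- The channel of a pi-calculus name. -/
def chanOf {k : ℕ} (e : Fin k → ℕ) : PiCalc.Name 𝒩 k → Chan 𝒩
  | .free a => .atom a
  | .bound i => .issued (e i)

theorem transName_envSub (p : Params 𝒩) {k : ℕ} (e : Fin k → ℕ) (x : PiCalc.Name 𝒩 k) :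
    (transName p.φ x).subst (envSub p e) = (chanOf e x).name p := by
  cases x with
  | free a => rw [transName, RhoCalc.Name.up_subst, RhoCalc.Name.up_zero]; rfl
  | bound i => rfl

theorem chanOf_injective {k : ℕ} {e : Fin k → ℕ} (he : Function.Injective e) :
    Function.Injective (chanOf (𝒩 := 𝒩) e) := by
  rintro (a | i) (b | j) h <;> simp only [chanOf] at h
  · cases h; rfl
  · cases h
  · cases h
  · rw [he (Chan.issued.inj h)]

/-- The copy of a replicated input. -/
def copyBody (p : Params 𝒩) {k : ℕ} (x : PiCalc.Name 𝒩 k) (P : PiCalc.Proc 𝒩 (k + 1))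
    (l : List Op) : RhoCalc.Proc k :=
  .input (transName p.φ x) (.par (RhoCalc.copier (RhoCalc.pathName p.n l))
    (trans p.φ p.v P (RhoCalc.pathName p.n (.dup :: l))))

namespace Item

variable {k : ℕ}

/-- The rho-calculus process of a component. -/
def interp (p : Params 𝒩) (e : Fin k → ℕ) : Item 𝒩 k → RhoCalc.Proc 0
  | inp x P l =>
      (RhoCalc.Proc.input (transName p.φ x) (trans p.φ p.v P (RhoCalc.pathName p.n l))).subst
        (envSub p e)
  | out x y => (RhoCalc.output (transName p.φ x) (transName p.φ y)).subst (envSub p e)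
  | request l => RhoCalc.output p.v (RhoCalc.pathName p.n l)
  | await P l =>
      .input (RhoCalc.pathName p.n l) ((trans p.φ p.v P (RhoCalc.pathName p.n (.dup :: l))).subst
        (RhoCalc.liftSub (envSub p e)))
  | answer l i => .lift (RhoCalc.pathName p.n l) (RhoCalc.issued p.s i)
  | copier l => RhoCalc.copier (RhoCalc.pathName p.n l)
  | store x P l => .lift (RhoCalc.pathName p.n l) ((copyBody p x P l).subst (envSub p e))
  | copy x P l => (copyBody p x P l).subst (envSub p e)
  | serverCopier => RhoCalc.copier p.x
  | serverStore => .lift p.x (RhoCalc.serverBody p.v p.x p.z)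
  | serverReady => RhoCalc.serverBody p.v p.x p.z
  | serverWait i =>
      .input p.v (.par (.par (RhoCalc.copier p.x) (.lift (.bound 0) (RhoCalc.issued p.s i).up))
        (.lift p.z.up (.lift (.quote (RhoCalc.issued p.s i)) .nil)))
  | serverNext i => .lift p.z (RhoCalc.issued p.s i)

/-- The pi-calculus process of a component. -/
def toPi : Item 𝒩 k → PiCalc.Proc 𝒩 k
  | inp x P _ => .input x P
  | out x y => .output x y
  | await P _ => .nu P
  | store x P _ => .repl x P
  | copy x P _ => .input x P
  | _ => .nil

/-- The component in the scope of one more binder. -/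
def weaken : Item 𝒩 k → Item 𝒩 (k + 1)
  | inp x P l => inp (x.subst fun i => .bound i.succ)
      (P.subst (PiCalc.liftSub fun i => .bound i.succ)) l
  | out x y => out (x.subst fun i => .bound i.succ) (y.subst fun i => .bound i.succ)
  | request l => request l
  | await P l => await (P.subst (PiCalc.liftSub fun i => .bound i.succ)) l
  | answer l i => answer l i
  | copier l => copier l
  | store x P l => store (x.subst fun i => .bound i.succ)
      (P.subst (PiCalc.liftSub fun i => .bound i.succ)) l
  | copy x P l => copy (x.subst fun i => .bound i.succ)
      (P.subst (PiCalc.liftSub fun i => .bound i.succ)) l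
  | serverCopier => serverCopier
  | serverStore => serverStore
  | serverReady => serverReady
  | serverWait i => serverWait i
  | serverNext i => serverNext i

theorem toPi_weaken (t : Item 𝒩 k) : t.weaken.toPi = t.toPi.weaken := by
  cases t <;> rfl

end Item

/-- The number of administrative steps that a translated process can cause before its next
communication. -/
def procWeight : {k : ℕ} → PiCalc.Proc 𝒩 k → ℕ
  | _, .nil => 0
  | _, .par P Q => procWeight P + procWeight Q
  | _, .input _ _ => 0
  | _, .output _ _ => 0
  | _, .nu P => procWeight P + 4
  | _, .repl _ _ => 1

theorem procWeight_subst : ∀ {k m : ℕ} (τ : Fin k → PiCalc.Name 𝒩 m) (P : PiCalc.Proc 𝒩 k),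
    procWeight (P.subst τ) = procWeight P
  | _, _, _, .nil => rfl
  | _, _, τ, .par P Q => by
      simp only [PiCalc.Proc.subst, procWeight, procWeight_subst τ P, procWeight_subst τ Q]
  | _, _, _, .input _ _ => rfl
  | _, _, _, .output _ _ => rfl
  | _, _, τ, .nu P => by
      simp only [PiCalc.Proc.subst, procWeight, procWeight_subst _ P]
  | _, _, _, .repl _ _ => rfl

/-- The free names of the process are in `S`, and `K` tells which parameters of the subprocesses
are used for a restriction. -/
def ProcOK (S : Set 𝒩) : {k : ℕ} → PiCalc.Proc 𝒩 k → (List Op → Bool) → Prop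
  | _, .nil, _ => True
  | _, .par P Q, K =>
      ProcOK S P (fun l => K (.left :: l)) ∧ ProcOK S Q (fun l => K (.right :: l))
  | _, .input x P, K => x.freeNames ⊆ S ∧ ProcOK S P K
  | _, .output x y, _ => x.freeNames ⊆ S ∧ y.freeNames ⊆ S
  | _, .nu P, K => K [] = true ∧ ProcOK S P (fun l => K (.dup :: l))
  | _, .repl x P, K => K [] = false ∧ x.freeNames ⊆ S ∧ ProcOK S P (fun l => K (.dup :: l))

/-- Parallel branches start their paths with different operations, and the body of a restriction or
replication extends the path strictly. The requirements on `K` thus never overlap and can be glued.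
-/
theorem exists_procOK (S : Set 𝒩) : ∀ {k : ℕ} (P : PiCalc.Proc 𝒩 k), P.freeNames ⊆ S →
    ∃ K, ProcOK S P K
  | _, .nil, _ => ⟨fun _ => true, trivial⟩
  | _, .par P Q, h => by
      obtain ⟨K, hK⟩ := exists_procOK S P (Set.subset_union_left.trans h)
      obtain ⟨L, hL⟩ := exists_procOK S Q (Set.subset_union_right.trans h)
      exact ⟨fun l => match l with
        | .left :: l => K l
        | .right :: l => L l
        | _ => true, hK, hL⟩
  | _, .input x P, h => by
      obtain ⟨K, hK⟩ := exists_procOK S P (Set.subset_union_right.trans h)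
      exact ⟨K, Set.subset_union_left.trans h, hK⟩
  | _, .output x y, h =>
      ⟨fun _ => true, Set.subset_union_left.trans h, Set.subset_union_right.trans h⟩
  | _, .nu P, h => by
      obtain ⟨K, hK⟩ := exists_procOK S P h
      -- The default covers the empty path, which is the parameter of this restriction, so it has to
      -- be `true`.
      exact ⟨fun l => match l with
        | .dup :: l => K l
        | _ => true, rfl, hK⟩
  | _, .repl x P, h => by
      obtain ⟨K, hK⟩ := exists_procOK S P (Set.subset_union_right.trans h)
      -- Here the empty path belongs to a replication, so the default has to be `false`.
      exact ⟨fun l => match l with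
        | .dup :: l => K l
        | _ => false, rfl, Set.subset_union_left.trans h, hK⟩

theorem freeNames_name_subst {S : Set 𝒩} {k m : ℕ} {τ : Fin k → PiCalc.Name 𝒩 m}
    (hτ : ∀ i, (τ i).freeNames ⊆ S) {x : PiCalc.Name 𝒩 k} (h : x.freeNames ⊆ S) :
    (x.subst τ).freeNames ⊆ S := by
  cases x with
  | free a => exact h
  | bound i => exact hτ i

theorem freeNames_liftSub {S : Set 𝒩} {k m : ℕ} {τ : Fin k → PiCalc.Name 𝒩 m}
    (hτ : ∀ i, (τ i).freeNames ⊆ S) (i : Fin (k + 1)) :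
    (PiCalc.liftSub τ i).freeNames ⊆ S := by
  refine Fin.cases (Set.empty_subset _) (fun i => ?_) i
  exact freeNames_name_subst (fun _ => Set.empty_subset _) (hτ i)

theorem ProcOK.subst {S : Set 𝒩} : ∀ {k m : ℕ} {τ : Fin k → PiCalc.Name 𝒩 m}
    (_ : ∀ i, (τ i).freeNames ⊆ S) (P : PiCalc.Proc 𝒩 k) {K : List Op → Bool},
    ProcOK S P K → ProcOK S (P.subst τ) K
  | _, _, _, _, .nil, _, h => h
  | _, _, _, hτ, .par P Q, _, h => ⟨ProcOK.subst hτ P h.1, ProcOK.subst hτ Q h.2⟩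
  | _, _, _, hτ, .input _ P, _, h =>
      ⟨freeNames_name_subst hτ h.1, ProcOK.subst (freeNames_liftSub hτ) P h.2⟩
  | _, _, _, hτ, .output _ _, _, h =>
      ⟨freeNames_name_subst hτ h.1, freeNames_name_subst hτ h.2⟩
  | _, _, _, hτ, .nu P, _, h => ⟨h.1, ProcOK.subst (freeNames_liftSub hτ) P h.2⟩
  | _, _, _, hτ, .repl _ P, _, h =>
      ⟨h.1, freeNames_name_subst hτ h.2.1, ProcOK.subst (freeNames_liftSub hτ) P h.2.2⟩

/-- The part of `K` for the parameters derived from the one with path `l`. -/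
def kindAt (K : List Op → Bool) (l : List Op) : List Op → Bool := fun l' => K (l.reverse ++ l')

/-- A path lists the latest operation first, whereas `K` reads operations from the outermost
constructor inwards; hence the reversal in `kindAt`. -/
theorem kindAt_cons (K : List Op → Bool) (o : Op) (l : List Op) :
    (fun l' => kindAt K l (o :: l')) = kindAt K (o :: l) := by
  funext l'
  simp [kindAt]

namespace Item

variable {k : ℕ}

/-- The server makes two internal steps, copying its body and fetching the next name, before it
waits on `v`: hence 2, 1 and 0 for its states. Answering a request restarts it, so a request weighs
one for its own step and two for the new turn. A waiting restriction pays one for the receipt and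
then for its body; a copier pays for a single unfolding. -/
def weight : Item 𝒩 k → ℕ
  | request _ => 3
  | await P _ => procWeight P + 1
  | copier _ => 1
  | serverCopier => 2
  | serverReady => 1
  | _ => 0

/-- The component uses only the atomic names in `S`, and its parameters as `K` tells. -/
def OK (S : Set 𝒩) (K : List Op → Bool) : Item 𝒩 k → Prop
  | inp x P l => x.freeNames ⊆ S ∧ ProcOK S P (kindAt K l)
  | out x y => x.freeNames ⊆ S ∧ y.freeNames ⊆ S
  | request l => kindAt K l [] = true
  | await P l => kindAt K l [] = true ∧ ProcOK S P (kindAt K (.dup :: l))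
  | answer l _ => kindAt K l [] = true
  | copier l => kindAt K l [] = false
  | store x P l => kindAt K l [] = false ∧ x.freeNames ⊆ S ∧ ProcOK S P (kindAt K (.dup :: l))
  | copy x P l => kindAt K l [] = false ∧ x.freeNames ⊆ S ∧ ProcOK S P (kindAt K (.dup :: l))
  | _ => True

/-- The name that the server issues next. -/
def next : Item 𝒩 k → Multiset ℕ
  | serverWait i => {i}
  | serverNext i => {i}
  | _ => 0

/-- The issued names that have not been received. -/
def pending : Item 𝒩 k → Multiset ℕ
  | answer _ i => {i}
  | _ => 0

theorem weight_weaken (t : Item 𝒩 k) : t.weaken.weight = t.weight := by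
  cases t <;> simp [weaken, weight, procWeight_subst]

theorem next_weaken (t : Item 𝒩 k) : t.weaken.next = t.next := by
  cases t <;> rfl

theorem pending_weaken (t : Item 𝒩 k) : t.weaken.pending = t.pending := by
  cases t <;> rfl

theorem OK.weaken {S : Set 𝒩} {K : List Op → Bool} {t : Item 𝒩 k} (h : t.OK S K) :
    t.weaken.OK S K := by
  have h₀ : ∀ i : Fin k, ((.bound i.succ : PiCalc.Name 𝒩 (k + 1))).freeNames ⊆ S :=
    fun _ => Set.empty_subset _
  have h₁ := freeNames_liftSub h₀
  cases t with
  | inp x P l => exact ⟨freeNames_name_subst h₀ h.1, h.2.subst h₁⟩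
  | out x y => exact ⟨freeNames_name_subst h₀ h.1, freeNames_name_subst h₀ h.2⟩
  | await P l => exact ⟨h.1, h.2.subst h₁⟩
  | store x P l => exact ⟨h.1, freeNames_name_subst h₀ h.2.1, h.2.2.subst h₁⟩
  | copy x P l => exact ⟨h.1, freeNames_name_subst h₀ h.2.1, h.2.2.subst h₁⟩
  | _ => exact h

theorem interp_primeCong (p : Params 𝒩) (e : Fin k → ℕ) (t : Item 𝒩 k) :
    RhoCalc.Proc.PrimeCong (t.interp p e) (t.interp p e) := by
  cases t <;> first
    | exact .input (.refl _) (.refl _)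
    | exact .lift (.refl _) (.refl _)

/-- A component that does not use the new name is unaffected by the value `i` assigned to it. This
lets the other components follow when a scope is opened. -/
theorem interp_weaken (p : Params 𝒩) (i : ℕ) (e : Fin k → ℕ) (t : Item 𝒩 k) :
    RhoCalc.Proc.PrimeCong (t.interp p e) (t.weaken.interp p (Fin.cases i e)) := by
  have h₀ : ∀ x : PiCalc.Name 𝒩 k, _ ∧ _ := transName_subst p.φ (fun i => .bound i.succ)
    (envSub p (Fin.cases i e : Fin (k + 1) → ℕ))
  have h₁ : ∀ (P : PiCalc.Proc 𝒩 (k + 1)) n, _ := trans_subst p.φ p.v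
    (PiCalc.liftSub fun i => .bound i.succ)
    (RhoCalc.liftSub (envSub p (Fin.cases i e : Fin (k + 1) → ℕ)))
  -- The lifted substitution now reads as the lift of the extended environment after a shift, which
  -- computes to the old environment.
  rw [← liftSub_nameSub] at h₁
  have hc : ∀ x P l, RhoCalc.Proc.PrimeCong ((copy x P l).interp p e)
      ((copy x P l).weaken.interp p (Fin.cases i e)) := by
    intro x P l
    refine .input (h₀ x).1.symm ?_
    simp only [RhoCalc.Proc.subst, RhoCalc.copier_subst]
    exact .par (.refl _) (h₁ P _).symm
  cases t with
  | inp x P l => exact .input (h₀ x).1.symm (h₁ P _).symm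
  | out x y =>
    refine .lift (h₀ x).1.symm ?_
    simp only [RhoCalc.Proc.subst]
    rw [(h₀ y).2]
    exact .refl _
  | await P l => exact .input (.refl _) (h₁ P _).symm
  | store x P l =>
    refine .lift (.refl _) ?_
    cases hc x P l with
    | input h h' => exact .input h h'
  | copy x P l => exact hc x P l
  | request l => exact interp_primeCong p e (request l)
  | answer l j => exact interp_primeCong p e (answer l j)
  | copier l => exact interp_primeCong p e (copier l)
  | serverCopier => exact interp_primeCong p e serverCopier
  | serverStore => exact interp_primeCong p e serverStore
  | serverReady => exact interp_primeCong p e serverReady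
  | serverWait j => exact interp_primeCong p e (serverWait j)
  | serverNext j => exact interp_primeCong p e (serverNext j)

end Item

/-- The components of a translated process. -/
def itemsOf : {k : ℕ} → PiCalc.Proc 𝒩 k → List Op → Multiset (Item 𝒩 k)
  | _, .nil, _ => 0
  | _, .par P Q, l => itemsOf P (.left :: l) + itemsOf Q (.right :: l)
  | _, .input x P, l => {.inp x P l}
  | _, .output x y, _ => {.out x y}
  | _, .nu P, l => {.request l} + {.await P l}
  | _, .repl x P, l => {.copier l} + {.store x P l}

theorem comps_trans (p : Params 𝒩) : ∀ {k : ℕ} (e : Fin k → ℕ) (P : PiCalc.Proc 𝒩 k) (l : List Op),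
    ((trans p.φ p.v P (RhoCalc.pathName p.n l)).subst (envSub p e)).comps =
      (itemsOf P l).map (Item.interp p e)
  | _, _, .nil, _ => rfl
  | _, e, .par P Q, l => by
      rw [itemsOf, Multiset.map_add, ← comps_trans p e P, ← comps_trans p e Q]
      rfl
  | _, _, .input _ _, _ => rfl
  | _, _, .output _ _, _ => rfl
  | _, _, .nu P, l => by
      simp only [itemsOf, trans, Multiset.map_add, Multiset.map_singleton, RhoCalc.Proc.subst,
        RhoCalc.output, RhoCalc.Name.up_subst, RhoCalc.Name.up_substDrop, RhoCalc.Proc.comps,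
        Item.interp, RhoCalc.Name.up_zero]
      rfl
  | _, _, .repl x P, l => by
      simp only [itemsOf, trans, Multiset.map_add, Multiset.map_singleton, RhoCalc.Proc.subst,
        RhoCalc.copier_subst, RhoCalc.Name.up_subst, RhoCalc.Proc.comps,
        Item.interp, RhoCalc.Name.up_zero, copyBody]
      rfl

theorem parAll_itemsOf : ∀ {k : ℕ} (P : PiCalc.Proc 𝒩 k) (l : List Op),
    (PiCalc.parAll ((itemsOf P l).map Item.toPi)).Cong P
  | _, .nil, _ => PiCalc.parAll_zero
  | _, .par P Q, l => by
      rw [itemsOf, Multiset.map_add]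
      exact (PiCalc.parAll_add _ _).trans (.par (parAll_itemsOf P _) (parAll_itemsOf Q _))
  | _, .input _ _, _ => PiCalc.parAll_singleton _
  | _, .output _ _, _ => PiCalc.parAll_singleton _
  | _, .nu P, _ => (PiCalc.parAll_cons _ _).trans
      ((PiCalc.Proc.Cong.nil_par _).trans (PiCalc.parAll_singleton _))
  | _, .repl x P, _ => (PiCalc.parAll_cons _ _).trans
      ((PiCalc.Proc.Cong.nil_par _).trans (PiCalc.parAll_singleton _))

theorem weight_itemsOf : ∀ {k : ℕ} (P : PiCalc.Proc 𝒩 k) (l : List Op),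
    ((itemsOf P l).map Item.weight).sum = procWeight P
  | _, .nil, _ => rfl
  | _, .par P Q, l => by
      rw [itemsOf, Multiset.map_add, Multiset.sum_add, weight_itemsOf P, weight_itemsOf Q]
      rfl
  | _, .input _ _, _ => rfl
  | _, .output _ _, _ => rfl
  | _, .nu P, _ => by
      simp [itemsOf, Item.weight, procWeight]
      omega
  | _, .repl x P, _ => rfl

theorem next_itemsOf : ∀ {k : ℕ} (P : PiCalc.Proc 𝒩 k) (l : List Op),
    (itemsOf P l).bind Item.next = 0
  | _, .nil, _ => rfl
  | _, .par P Q, l => by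
      rw [itemsOf, Multiset.add_bind, next_itemsOf P, next_itemsOf Q, add_zero]
  | _, .input _ _, _ => rfl
  | _, .output _ _, _ => rfl
  | _, .nu P, _ => rfl
  | _, .repl x P, _ => rfl

theorem pending_itemsOf : ∀ {k : ℕ} (P : PiCalc.Proc 𝒩 k) (l : List Op),
    (itemsOf P l).bind Item.pending = 0
  | _, .nil, _ => rfl
  | _, .par P Q, l => by
      rw [itemsOf, Multiset.add_bind, pending_itemsOf P, pending_itemsOf Q, add_zero]
  | _, .input _ _, _ => rfl
  | _, .output _ _, _ => rfl
  | _, .nu P, _ => rfl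
  | _, .repl x P, _ => rfl

theorem ok_itemsOf {S : Set 𝒩} {K : List Op → Bool} : ∀ {k : ℕ} (P : PiCalc.Proc 𝒩 k)
    (l : List Op), ProcOK S P (kindAt K l) → ∀ t ∈ itemsOf P l, t.OK S K
  | _, .nil, _, _, t, ht => by simp [itemsOf] at ht
  | _, .par P Q, l, h, t, ht => by
      simp only [ProcOK, kindAt_cons] at h
      rcases Multiset.mem_add.1 ht with ht | ht
      · exact ok_itemsOf P _ h.1 t ht
      · exact ok_itemsOf Q _ h.2 t ht
  | _, .input _ _, _, h, t, ht => by
      rw [Multiset.mem_singleton.1 ht]; exact h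
  | _, .output _ _, _, h, t, ht => by
      rw [Multiset.mem_singleton.1 ht]; exact h
  | _, .nu P, _, h, t, ht => by
      simp only [ProcOK, kindAt_cons] at h
      rcases Multiset.mem_add.1 ht with ht | ht <;> rw [Multiset.mem_singleton.1 ht]
      · exact h.1
      · exact h
  | _, .repl x P, _, h, t, ht => by
      simp only [ProcOK, kindAt_cons] at h
      rcases Multiset.mem_add.1 ht with ht | ht <;> rw [Multiset.mem_singleton.1 ht]
      · exact h.1
      · exact h

end PiToRho

-- The simulation relation

namespace PiToRho

open RhoCalc (Op Sub CompsCong)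

variable {𝒩 : Type*}

namespace Item

variable {k : ℕ}

/-- The channel on which an input component receives. -/
def inChan (e : Fin k → ℕ) : Item 𝒩 k → Option (Chan 𝒩)
  | inp x _ _ => some (chanOf e x)
  | await _ l => some (.path l)
  | copier l => some (.path l)
  | copy x _ _ => some (chanOf e x)
  | serverCopier => some .x
  | serverReady => some .z
  | serverWait _ => some .v
  | _ => none

/-- The channel on which an output component sends. -/
def outChan (e : Fin k → ℕ) : Item 𝒩 k → Option (Chan 𝒩)
  | out x _ => some (chanOf e x)
  | request _ => some .v
  | answer l _ => some (.path l)
  | store _ _ l => some (.path l)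
  | serverStore => some .x
  | serverNext _ => some .z
  | _ => none

theorem chanOf_ok {S : Set 𝒩} (e : Fin k → ℕ) {x : PiCalc.Name 𝒩 k} (h : x.freeNames ⊆ S) :
    (chanOf e x).OK S := by
  cases x with
  | free a => exact h rfl
  | bound i => trivial

theorem inChan_of_interp {p : Params 𝒩} {S : Set 𝒩} {K : List Op → Bool} {e : Fin k → ℕ}
    {t : Item 𝒩 k} {c : RhoCalc.Name 0} {P : RhoCalc.Proc 1} (h : t.interp p e = .input c P)
    (ht : t.OK S K) : ∃ ch, t.inChan e = some ch ∧ c = ch.name p ∧ ch.OK S := by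
  cases t <;> cases h
  · exact ⟨_, rfl, transName_envSub p e _, chanOf_ok e ht.1⟩
  · exact ⟨_, rfl, rfl, trivial⟩
  · exact ⟨_, rfl, RhoCalc.Name.up_zero _, trivial⟩
  · exact ⟨_, rfl, transName_envSub p e _, chanOf_ok e ht.2.1⟩
  · exact ⟨_, rfl, RhoCalc.Name.up_zero _, trivial⟩
  · exact ⟨_, rfl, rfl, trivial⟩
  · exact ⟨_, rfl, rfl, trivial⟩

theorem outChan_of_interp {p : Params 𝒩} {S : Set 𝒩} {K : List Op → Bool} {e : Fin k → ℕ}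
    {t : Item 𝒩 k} {c : RhoCalc.Name 0} {P : RhoCalc.Proc 0} (h : t.interp p e = .lift c P)
    (ht : t.OK S K) : ∃ ch, t.outChan e = some ch ∧ c = ch.name p ∧ ch.OK S := by
  cases t <;> cases h
  · exact ⟨_, rfl, transName_envSub p e _, chanOf_ok e ht.1⟩
  · exact ⟨_, rfl, rfl, trivial⟩
  · exact ⟨_, rfl, rfl, trivial⟩
  · exact ⟨_, rfl, rfl, trivial⟩
  · exact ⟨_, rfl, rfl, trivial⟩
  · exact ⟨_, rfl, rfl, trivial⟩

end Item

theorem exists_cons_of_map_eq_cons {α β : Type*} {f : α → β} {s : Multiset α} {b : β}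
    {t : Multiset β} (h : s.map f = b ::ₘ t) : ∃ a s', s = a ::ₘ s' ∧ f a = b ∧ s'.map f = t := by
  classical
  obtain ⟨a, ha, hb, ht⟩ := (Multiset.map_eq_cons _ _ _ _).2 h
  exact ⟨a, s.erase a, (Multiset.cons_erase ha).symm, hb, ht⟩

/-- The server is about to issue one name, which is new, and no issued name is used twice. -/
def NamesOK {k : ℕ} (e : Fin k → ℕ) (M : Multiset (Item 𝒩 k)) : Prop :=
  ∃ N, M.bind Item.next = {N} ∧ ((List.ofFn e : Multiset ℕ) + M.bind Item.pending).Nodup ∧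
    ∀ i ∈ (List.ofFn e : Multiset ℕ) + M.bind Item.pending, i < N

/-- Distinct restricted names have received distinct issued names, so two components that
communicate on an issued name share the same π-name. -/
theorem NamesOK.injective {k : ℕ} {e : Fin k → ℕ} {M : Multiset (Item 𝒩 k)} (h : NamesOK e M) :
    Function.Injective e := by
  obtain ⟨N, -, h, -⟩ := h
  exact List.nodup_ofFn.1 (Multiset.coe_nodup.1 (Multiset.nodup_add.1 h).1)

/-- `T` is reachable from the translation of a pi-calculus process that reduces to `Q`, and `w`
bounds the number of its administrative steps. -/
structure Simulates (p : Params 𝒩) (S : Set 𝒩) (K : List Op → Bool) (T : RhoCalc.Proc 0)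
    (Q : PiCalc.Proc 𝒩 0) (w : ℕ) {k : ℕ} (e : Fin k → ℕ) (M : Multiset (Item 𝒩 k)) : Prop where
  comps : CompsCong T.comps (M.map (Item.interp p e))
  cong : Q.Cong (PiCalc.nuAll k (PiCalc.parAll (M.map Item.toPi)))
  ok : ∀ t ∈ M, t.OK S K
  names : NamesOK e M
  weight : (M.map Item.weight).sum = w

/-- Some multiset of components relates the two processes. -/
def Simulation (p : Params 𝒩) (S : Set 𝒩) (K : List Op → Bool) (T : RhoCalc.Proc 0)
    (Q : PiCalc.Proc 𝒩 0) (w : ℕ) : Prop :=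
  ∃ (k : ℕ) (e : Fin k → ℕ) (M : Multiset (Item 𝒩 k)), Simulates p S K T Q w e M

-- Effect of a single communication on the components

section Steps

variable {p : Params 𝒩} {S : Set 𝒩} {K : List Op → Bool} {k : ℕ} {e : Fin k → ℕ}

theorem comps_inst_trans (p : Params 𝒩) {k : ℕ} (e : Fin k → ℕ) (P : PiCalc.Proc 𝒩 (k + 1))
    (y : PiCalc.Name 𝒩 k) (l : List Op) :
    CompsCong (((trans p.φ p.v P (RhoCalc.pathName p.n l)).subst
        (RhoCalc.liftSub (envSub p e))).inst ((transName p.φ y).substDrop (envSub p e))).comps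
      ((itemsOf (P.inst y) l).map (Item.interp p e)) := by
  rw [← comps_trans]
  refine RhoCalc.Proc.Cong.comps ?_
  refine .trans ?_ (trans_subst p.φ p.v _ _ P _).symm
  unfold envSub
  rw [RhoCalc.Proc.subst_liftSub_inst]
  -- The lifted object is the drop of `y` after substitution: an issued process if `y` is bound, the
  -- drop of the atomic name if `y` is free.
  have hy : Sum.inr ((transName p.φ y).substDrop fun i => Sum.inr (RhoCalc.issued p.s (e i))) =
      nameSub p.φ (fun i => Sum.inr (RhoCalc.issued p.s (e i)) : Sub k 0) y := by
    cases y with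
    | free a => rw [transName, RhoCalc.Name.up_substDrop, RhoCalc.Name.up_zero]; rfl
    | bound j => simp [transName, RhoCalc.Name.substDrop, nameSub]
  rw [hy]
  refine RhoCalc.Proc.subst_congr (fun i => ?_) _
  refine Fin.cases ?_ (fun i => .inr (.refl _)) i
  cases y with
  | free a => exact .inr (.refl _)
  | bound j => exact .inr (.refl _)

theorem comps_inst_issued (p : Params 𝒩) {k : ℕ} (e : Fin k → ℕ) (P : PiCalc.Proc 𝒩 (k + 1))
    (i : ℕ) (l : List Op) :
    (((trans p.φ p.v P (RhoCalc.pathName p.n l)).subst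
        (RhoCalc.liftSub (envSub p e))).inst (RhoCalc.issued p.s i)).comps =
      (itemsOf P l).map (Item.interp p (Fin.cases i e : Fin (k + 1) → ℕ)) := by
  rw [← comps_trans]
  unfold envSub
  rw [RhoCalc.Proc.subst_liftSub_inst]
  congr 2
  funext j
  exact Fin.cases rfl (fun _ => rfl) j

/-- This serves every step except the issue and the receipt of a name: the multisets of next and
pending names do not change. -/
theorem NamesOK.replace {t₁ t₂ : Item 𝒩 k} {R N : Multiset (Item 𝒩 k)}
    (h : NamesOK e (t₁ ::ₘ t₂ ::ₘ R)) (hn : N.bind Item.next = t₁.next + t₂.next)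
    (hp : N.bind Item.pending = t₁.pending + t₂.pending) : NamesOK e (N + R) := by
  simpa only [NamesOK, Multiset.add_bind, Multiset.cons_bind, hn, hp, add_assoc] using h

theorem parAll_map_cons_cons (t₁ t₂ : Item 𝒩 k) (R : Multiset (Item 𝒩 k)) :
    (PiCalc.parAll ((t₁ ::ₘ t₂ ::ₘ R).map Item.toPi)).Cong
      (.par (.par t₁.toPi t₂.toPi) (PiCalc.parAll (R.map Item.toPi))) := by
  rw [Multiset.map_cons, Multiset.map_cons]
  exact (PiCalc.parAll_cons _ _).trans
    ((PiCalc.Proc.Cong.par (.refl _) (PiCalc.parAll_cons _ _)).trans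
      (PiCalc.Proc.Cong.par_assoc _ _ _).symm)

variable {T T' X : RhoCalc.Proc 0} {Q Q' : PiCalc.Proc 𝒩 0} {w : ℕ} {t₁ t₂ : Item 𝒩 k}
  {R : Multiset (Item 𝒩 k)}

theorem Simulates.replace (h : Simulates p S K T Q w e (t₁ ::ₘ t₂ ::ₘ R))
    (N : Multiset (Item 𝒩 k)) (hT : CompsCong T'.comps (X.comps + R.map (Item.interp p e)))
    (hX : CompsCong X.comps (N.map (Item.interp p e)))
    (hQ : Q'.Cong (PiCalc.nuAll k (.par (PiCalc.parAll (N.map Item.toPi))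
      (PiCalc.parAll (R.map Item.toPi)))))
    (hok : ∀ t ∈ N, t.OK S K) (hN : NamesOK e (N + R)) :
    Simulation p S K T' Q' ((N.map Item.weight).sum + (R.map Item.weight).sum) := by
  refine ⟨k, e, N + R, ⟨?_, ?_, ?_, hN, by simp⟩⟩
  · rw [Multiset.map_add]
    refine hT.trans (hX.add ?_)
    rw [Multiset.rel_map]
    exact Multiset.rel_refl_of_refl_on fun t _ => t.interp_primeCong p e
  · rw [Multiset.map_add]
    exact hQ.trans (PiCalc.parAll_add _ _).symm.nuAll
  · intro t ht
    rcases Multiset.mem_add.1 ht with ht | ht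
    · exact hok t ht
    · exact h.ok t (Multiset.mem_cons_of_mem (Multiset.mem_cons_of_mem ht))

theorem Simulates.weight_eq (h : Simulates p S K T Q w e (t₁ ::ₘ t₂ ::ₘ R)) :
    w = t₁.weight + t₂.weight + (R.map Item.weight).sum := by
  rw [← h.weight]
  simp [add_assoc]

/-- Administrative steps leave the pi-calculus process unchanged. -/
theorem Simulates.admin (h : Simulates p S K T Q w e (t₁ ::ₘ t₂ ::ₘ R))
    (N : Multiset (Item 𝒩 k)) (hT : CompsCong T'.comps (X.comps + R.map (Item.interp p e)))
    (hX : CompsCong X.comps (N.map (Item.interp p e)))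
    (hQ : PiCalc.Proc.Cong (.par t₁.toPi t₂.toPi) (PiCalc.parAll (N.map Item.toPi)))
    (hok : ∀ t ∈ N, t.OK S K) (hN : NamesOK e (N + R))
    (hw : (N.map Item.weight).sum < t₁.weight + t₂.weight) :
    ∃ w' < w, Simulation p S K T' Q w' := by
  refine ⟨_, ?_, h.replace N hT hX (h.cong.trans (PiCalc.Proc.Cong.nuAll
    ((parAll_map_cons_cons _ _ _).trans (.par hQ (.refl _))))) hok hN⟩
  rw [h.weight_eq]
  omega

/-- Communications on other names are reductions of the pi-calculus process. -/
theorem Simulates.communication (h : Simulates p S K T Q w e (t₁ ::ₘ t₂ ::ₘ R))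
    {x y : PiCalc.Name 𝒩 k} {P : PiCalc.Proc 𝒩 (k + 1)} (h₁ : t₁.toPi = .input x P)
    (h₂ : t₂.toPi = .output x y)
    (N : Multiset (Item 𝒩 k)) (hT : CompsCong T'.comps (X.comps + R.map (Item.interp p e)))
    (hX : CompsCong X.comps (N.map (Item.interp p e)))
    (hQ : (P.inst y).Cong (PiCalc.parAll (N.map Item.toPi)))
    (hok : ∀ t ∈ N, t.OK S K) (hN : NamesOK e (N + R)) :
    ∃ Q' w', PiCalc.Step Q Q' ∧ Simulation p S K T' Q' w' := by
  refine ⟨_, _, .struct (h.cong.trans (parAll_map_cons_cons _ _ _).nuAll) ?_ (.refl _),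
    h.replace N hT hX (PiCalc.Proc.Cong.nuAll (.par hQ (.refl _))) hok hN⟩
  rw [h₁, h₂]
  exact PiCalc.Step.nuAll (.par _ (.com x y P))

/-- The receipt of an issued name is the opening of the scope of a restriction. -/
theorem Simulates.receive {P : PiCalc.Proc 𝒩 (k + 1)} {l : List Op} {i : ℕ}
    (h : Simulates p S K T Q w e (.await P l ::ₘ .answer l i ::ₘ R))
    (hT : CompsCong T'.comps ((((trans p.φ p.v P (RhoCalc.pathName p.n (.dup :: l))).subst
      (RhoCalc.liftSub (envSub p e))).inst (RhoCalc.issued p.s i)).comps +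
        R.map (Item.interp p e))) :
    ∃ w' < w, Simulation p S K T' Q w' := by
  refine ⟨procWeight P + (R.map Item.weight).sum, ?_, k + 1, (Fin.cases i e : Fin (k + 1) → ℕ),
    itemsOf P (.dup :: l) + R.map Item.weaken, ?_, ?_, ?_, ?_, ?_⟩
  · rw [h.weight_eq]
    simp only [Item.weight]
    omega
  · rw [comps_inst_issued] at hT
    rw [Multiset.map_add]
    refine hT.trans (.add ?_ ?_)
    · rw [Multiset.rel_map]
      exact Multiset.rel_refl_of_refl_on fun t _ => t.interp_primeCong p _
    · rw [Multiset.map_map, Multiset.rel_map]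
      exact Multiset.rel_refl_of_refl_on fun t _ => t.interp_weaken p i e
  · refine h.cong.trans ?_
    -- The answer means nil, and the scope of the waiting restriction is extruded over all other
    -- components.
    refine .trans (PiCalc.Proc.Cong.nuAll ((parAll_map_cons_cons _ _ _).trans
      ((PiCalc.Proc.Cong.par (.par_nil _) (.refl _)).trans (.nu_par _ _)))) ?_
    refine PiCalc.Proc.Cong.nuAll (k := k + 1) ?_
    rw [Multiset.map_add, Multiset.map_map]
    have : R.map (Item.toPi ∘ Item.weaken) = (R.map Item.toPi).map PiCalc.Proc.weaken := by
      rw [Multiset.map_map]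
      exact Multiset.map_congr rfl fun t _ => t.toPi_weaken
    rw [this]
    exact (PiCalc.Proc.Cong.par (parAll_itemsOf _ _).symm
      (PiCalc.parAll_map_weaken _).symm).trans (PiCalc.parAll_add _ _).symm
  · intro t ht
    rcases Multiset.mem_add.1 ht with ht | ht
    · exact ok_itemsOf P _ (h.ok _ (Multiset.mem_cons_self _ _)).2 t ht
    · obtain ⟨t, hR, rfl⟩ := Multiset.mem_map.1 ht
      exact (h.ok t (Multiset.mem_cons_of_mem (Multiset.mem_cons_of_mem hR))).weaken
  · have hn : (R.map Item.weaken).bind Item.next = R.bind Item.next := by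
      simp only [Multiset.bind, Multiset.map_map, Function.comp_def, Item.next_weaken]
    have hp : (R.map Item.weaken).bind Item.pending = R.bind Item.pending := by
      simp only [Multiset.bind, Multiset.map_map, Function.comp_def, Item.pending_weaken]
    -- The received index moves from the pending names to the environment, so the multiset of names
    -- in use is the same.
    have he : ((List.ofFn (Fin.cases i e : Fin (k + 1) → ℕ) : List ℕ) : Multiset ℕ) =
        (List.ofFn e : Multiset ℕ) + {i} := by
      rw [List.ofFn_succ, ← Multiset.cons_coe, ← Multiset.singleton_add, add_comm]
      rfl
    have := h.names
    simpa only [NamesOK, Multiset.add_bind, Multiset.cons_bind, hn, hp, he, next_itemsOf,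
      pending_itemsOf, Item.next, Item.pending, zero_add, add_assoc] using this
  · rw [Multiset.map_add, Multiset.sum_add, weight_itemsOf, Multiset.map_map]
    congr 2
    exact Multiset.map_congr rfl fun t _ => t.weight_weaken

/-- A request is answered by a name that has not been issued before. -/
theorem NamesOK.issue {i : ℕ} {l : List Op}
    (h : NamesOK e (.serverWait i ::ₘ .request l ::ₘ R)) :
    NamesOK e ({.serverCopier} + {.answer l i} + {.serverNext (i + 1)} + R) := by
  obtain ⟨N, hN, hd, hlt⟩ := h
  simp only [Multiset.cons_bind, Item.next, Item.pending, zero_add] at hN hd hlt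
  -- There is only one next name, so the waiting server holds it; all names in use lie below it.
  have hR : i = N ∧ R.bind Item.next = 0 := by
    rw [Multiset.singleton_add, ← Multiset.cons_zero, Multiset.cons_eq_cons] at hN
    rcases hN with h | ⟨_, _, _, h⟩
    · exact h
    · exact absurd h.symm (Multiset.cons_ne_zero)
  obtain ⟨rfl, hR⟩ := hR
  refine ⟨i + 1, ?_, ?_, ?_⟩
  · simp [Item.next, hR]
  · simp only [Multiset.add_bind, Multiset.singleton_bind, Item.pending, zero_add, add_zero]
    rw [add_left_comm, Multiset.singleton_add, Multiset.nodup_cons]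
    exact ⟨fun h => (hlt i h).false, hd⟩
  · simp only [Multiset.add_bind, Multiset.singleton_bind, Item.pending, zero_add, add_zero]
    rw [add_left_comm, Multiset.singleton_add]
    intro j hj
    rcases Multiset.mem_cons.1 hj with rfl | hj
    · omega
    · exact (hlt j hj).trans (Nat.lt_succ_self _)

end Steps

/-- The two components must have the same channel, which leaves nine pairs of shapes; `K` excludes
two of them. Each remaining pair either lowers the weight or performs a π-step, after which the
weight may be arbitrary. -/
theorem Simulation.step {p : Params 𝒩} {S : Set 𝒩} (hp : p.Injective S) {K : List Op → Bool}
    {A : Set (RhoCalc.Name 0)} {T T' : RhoCalc.Proc 0} {Q : PiCalc.Proc 𝒩 0} {w : ℕ}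
    (h : Simulation p S K T Q w) (hs : RhoCalc.StepOn A T T') :
    ∃ c ∈ A, ∃ ch : Chan 𝒩, ch.OK S ∧ RhoCalc.Name.Equiv c (ch.name p) ∧
      (ch.Admin ∧ (∃ w' < w, Simulation p S K T' Q w') ∨
        ¬ ch.Admin ∧ ∃ Q' w', PiCalc.Step Q Q' ∧ Simulation p S K T' Q' w') := by
  obtain ⟨k, e, M, h⟩ := h
  obtain ⟨c, hc, x₁, x₂, P₁, P₂, R, hM, hcx, hxx, hT⟩ := hs.comps _ h.comps
  obtain ⟨t₁, M, rfl, h₁, hM'⟩ := exists_cons_of_map_eq_cons hM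
  obtain ⟨t₂, R, rfl, h₂, rfl⟩ := exists_cons_of_map_eq_cons hM'
  clear hM hM'
  have ok₁ := h.ok t₁ (Multiset.mem_cons_self _ _)
  have ok₂ := h.ok t₂ (Multiset.mem_cons_of_mem (Multiset.mem_cons_self _ _))
  obtain ⟨ch, hi, rfl, hch⟩ := Item.inChan_of_interp h₁ ok₁
  obtain ⟨ch', ho, rfl, hch'⟩ := Item.outChan_of_interp h₂ ok₂
  obtain rfl := hp _ _ hch hch' hxx
  refine ⟨c, hc, ch, hch, hcx, ?_⟩
  have hinj := chanOf_injective (𝒩 := 𝒩) h.names.injective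
  -- A π-name denotes an atomic or an issued name, so translated inputs and outputs never interact
  -- with bookkeeping components.
  have hna : ∀ x : PiCalc.Name 𝒩 k, ¬ (chanOf e x).Admin := by rintro (_ | _) <;> exact id
  have hne : ∀ x : PiCalc.Name 𝒩 k, chanOf e x ≠ .v ∧ chanOf e x ≠ .x ∧ chanOf e x ≠ .z ∧
      ∀ l, chanOf e x ≠ .path l := by rintro (_ | _) <;> simp [chanOf]
  have hsub : ∀ {y : PiCalc.Name 𝒩 k}, y.freeNames ⊆ S → ∀ i,
      (Fin.cases y PiCalc.Name.bound i : PiCalc.Name 𝒩 k).freeNames ⊆ S :=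
    fun hy i => Fin.cases hy (fun _ => Set.empty_subset _) i
  cases t₁ <;> simp only [Item.inChan, Option.some.injEq, reduceCtorEq] at hi <;> subst hi <;>
    cases t₂ <;> simp only [Item.outChan, Option.some.injEq, reduceCtorEq, hne, Ne.symm (hne _).1,
      Ne.symm (hne _).2.1, Ne.symm (hne _).2.2.1, Ne.symm ((hne _).2.2.2 _), Chan.path.injEq] at ho
  case inp.out x P l x' y =>
    obtain rfl := hinj ho
    obtain rfl := (RhoCalc.Proc.input.inj h₁).2
    obtain rfl := (RhoCalc.Proc.lift.inj h₂).2
    refine .inr ⟨hna _, h.communication rfl rfl (itemsOf (P.inst y) l) hT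
      (comps_inst_trans p e P y l) (parAll_itemsOf _ _).symm
      (ok_itemsOf _ _ (ok₁.2.subst (hsub ok₂.2)))
      (h.names.replace (next_itemsOf _ _) (pending_itemsOf _ _))⟩
  case copy.out x P l x' y =>
    obtain rfl := hinj ho
    obtain rfl := (RhoCalc.Proc.input.inj h₁).2
    obtain rfl := (RhoCalc.Proc.lift.inj h₂).2
    refine .inr ⟨hna _, h.communication rfl rfl ({.copier l} + itemsOf (P.inst y) (.dup :: l)) hT
      ?_ ?_ ?_ (h.names.replace ?_ ?_)⟩
    · rw [Multiset.map_add, Multiset.map_singleton]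
      simp only [RhoCalc.Proc.subst, RhoCalc.Proc.inst, RhoCalc.copier_subst, RhoCalc.Proc.comps]
      exact .add (RhoCalc.CompsCong.singleton (Item.interp_primeCong p e (.copier l)))
        (comps_inst_trans p e P y (.dup :: l))
    · rw [Multiset.map_add, Multiset.map_singleton, Multiset.singleton_add]
      exact ((PiCalc.parAll_cons _ _).trans ((PiCalc.Proc.Cong.nil_par _).trans
        (parAll_itemsOf _ _))).symm
    · intro t ht
      rcases Multiset.mem_add.1 ht with ht | ht
      · rw [Multiset.mem_singleton.1 ht]
        exact ok₁.1
      · exact ok_itemsOf _ _ (ok₁.2.2.subst (hsub ok₂.2)) t ht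
    · simp [next_itemsOf, Item.next]
    · simp [pending_itemsOf, Item.pending]
  case await.answer P l l' i =>
    subst ho
    obtain rfl := (RhoCalc.Proc.input.inj h₁).2
    obtain rfl := (RhoCalc.Proc.lift.inj h₂).2
    exact .inl ⟨trivial, h.receive hT⟩
  case await.store P l x P' l' =>
    subst ho
    -- The path would serve both a restriction and a replication.
    exact absurd (ok₁.1.symm.trans ok₂.1) (by decide)
  case copier.answer l l' i =>
    subst ho
    exact absurd (Eq.trans (Eq.symm ok₁) ok₂) (by decide)
  case copier.store l x P l' =>
    subst ho
    obtain rfl := (RhoCalc.Proc.input.inj h₁).2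
    obtain rfl := (RhoCalc.Proc.lift.inj h₂).2
    rw [RhoCalc.copier_inst] at hT
    refine .inl ⟨trivial, h.admin ({.copy x P l'} + {.store x P l'}) hT ?_ ?_ ?_
      (h.names.replace rfl rfl) ?_⟩
    · rw [Multiset.map_add, Multiset.map_singleton, Multiset.map_singleton]
      exact .add (RhoCalc.CompsCong.singleton (Item.interp_primeCong p e (.copy x P l')))
        (RhoCalc.CompsCong.singleton (Item.interp_primeCong p e (.store x P l')))
    · refine (PiCalc.Proc.Cong.nil_par _).trans ((PiCalc.Proc.Cong.repl_unfold _ _).trans ?_)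
      exact ((PiCalc.parAll_cons _ _).trans (.par (.refl _) (PiCalc.parAll_singleton _))).symm
    · intro t ht
      rcases Multiset.mem_add.1 ht with ht | ht <;> rw [Multiset.mem_singleton.1 ht] <;> exact ok₂
    · simp [Item.weight]
  case serverCopier.serverStore =>
    obtain rfl := (RhoCalc.Proc.input.inj h₁).2
    obtain rfl := (RhoCalc.Proc.lift.inj h₂).2
    rw [RhoCalc.copier_inst] at hT
    refine .inl ⟨trivial, h.admin ({.serverReady} + {.serverStore}) hT ?_ ?_ ?_
      (h.names.replace rfl rfl) ?_⟩
    · exact .add (RhoCalc.CompsCong.singleton (Item.interp_primeCong p e .serverReady))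
        (RhoCalc.CompsCong.singleton (Item.interp_primeCong p e .serverStore))
    · exact ((PiCalc.parAll_cons _ _).trans (.par (.refl _) (PiCalc.parAll_singleton _))).symm
    · intro t ht
      rcases Multiset.mem_add.1 ht with ht | ht <;> rw [Multiset.mem_singleton.1 ht] <;> trivial
    · simp [Item.weight]
  case serverReady.serverNext i =>
    obtain rfl := (RhoCalc.Proc.input.inj h₁).2
    obtain rfl := (RhoCalc.Proc.lift.inj h₂).2
    refine .inl ⟨trivial, h.admin {.serverWait i} hT ?_ ?_ ?_ (h.names.replace ?_ ?_) ?_⟩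
    · simp only [RhoCalc.Proc.inst, RhoCalc.Proc.subst, RhoCalc.copier_subst,
        RhoCalc.Name.up_subst, RhoCalc.Proc.comps, Multiset.map_singleton, RhoCalc.Name.up_zero]
      exact RhoCalc.CompsCong.singleton (Item.interp_primeCong p e (.serverWait i))
    · exact (PiCalc.Proc.Cong.par_nil _).trans (PiCalc.parAll_singleton _).symm
    · intro t ht
      rw [Multiset.mem_singleton.1 ht]
      trivial
    · simp [Item.next]
    · simp [Item.pending]
    · simp [Item.weight]
  case serverWait.request i l =>
    obtain rfl := (RhoCalc.Proc.input.inj h₁).2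
    obtain rfl := (RhoCalc.Proc.lift.inj h₂).2
    refine .inl ⟨trivial, h.admin ({.serverCopier} + {.answer l i} + {.serverNext (i + 1)}) hT
      ?_ ?_ ?_ ?_ ?_⟩
    · simp only [RhoCalc.Proc.inst, RhoCalc.Proc.subst, RhoCalc.copier_subst,
        RhoCalc.Name.up_subst, RhoCalc.Proc.up_subst, RhoCalc.Proc.comps, RhoCalc.Proc.up_zero]
      refine .add (.add (RhoCalc.CompsCong.singleton (Item.interp_primeCong p e .serverCopier))
        (RhoCalc.CompsCong.singleton (.lift ?_ (.refl _))))
        (RhoCalc.CompsCong.singleton (.lift ?_ (.refl _)))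
      · have hq := RhoCalc.Name.quote_drop_equiv (k := 0) (RhoCalc.pathName p.n l)
        rw [RhoCalc.Name.up_zero] at hq
        exact hq
      · rw [RhoCalc.Name.up_zero]
        exact .refl _
    · exact ((PiCalc.parAll_add _ _).trans (.par ((PiCalc.parAll_add _ _).trans
        (.par (PiCalc.parAll_singleton _) (PiCalc.parAll_singleton _)))
        (PiCalc.parAll_singleton _))).trans (.par_nil _) |>.symm
    · intro t ht
      rcases Multiset.mem_add.1 ht with ht | ht
      · rcases Multiset.mem_add.1 ht with ht | ht <;> rw [Multiset.mem_singleton.1 ht]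
        · trivial
        · exact ok₂
      · rw [Multiset.mem_singleton.1 ht]
        trivial
    · exact h.names.issue
    · simp [Item.weight]

/-- The components of the name server in its initial state. -/
theorem Simulation.encode {φ : 𝒩 → RhoCalc.Name 0} {P : PiCalc.Proc 𝒩 0} {S : Set 𝒩}
    {K : List Op → Bool} (hK : ProcOK S P K) (n v x z s : RhoCalc.Name 0) :
    ∃ w, Simulation ⟨φ, n, v, x, z, s⟩ S K (PiToRho.encode φ P n v x z s) P w := by
  -- No name has been received yet, and the first name to be issued has index 0, since `issued s 0`
  -- is the drop of `s`.
  refine ⟨_, 0, Fin.elim0, itemsOf P [] + ({.serverCopier} + {.serverStore} + {.serverNext 0}),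
    ?_, ?_, ?_, ?_, rfl⟩
  · rw [Multiset.map_add, ← comps_trans, RhoCalc.Proc.subst_zero]
    exact RhoCalc.Proc.comps_refl _
  · rw [Multiset.map_add]
    refine ((PiCalc.parAll_add _ _).trans (.trans (.par (parAll_itemsOf P []) ?_)
      (.par_nil P))).symm
    exact ((PiCalc.parAll_add _ _).trans (.par ((PiCalc.parAll_add _ _).trans
        (.par (PiCalc.parAll_singleton _) (PiCalc.parAll_singleton _)))
        (PiCalc.parAll_singleton _))).trans ((PiCalc.Proc.Cong.par_nil _).trans (.par_nil _))
  · intro t ht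
    rcases Multiset.mem_add.1 ht with ht | ht
    · exact ok_itemsOf P [] hK t ht
    · simp only [Multiset.mem_add, Multiset.mem_singleton] at ht
      rcases ht with (rfl | rfl) | rfl <;> trivial
  · refine ⟨0, ?_, ?_, ?_⟩ <;>
      simp [next_itemsOf, pending_itemsOf, Item.next, Item.pending]

-- From the simulation to divergence

theorem Params.Injective.admin {p : Params 𝒩} {S : Set 𝒩} (hp : p.Injective S) {ch : Chan 𝒩}
    (hch : ch.OK S) {c : RhoCalc.Name 0} (hc : c ∈ adminNames p.n p.v p.x p.z)
    (h : RhoCalc.Name.Equiv c (ch.name p)) : ch.Admin := by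
  rcases hc with (hc | hc | hc) | hc
  · rw [← hp .v ch trivial hch (hc.symm.trans h)]; trivial
  · rw [← hp .x ch trivial hch (hc.symm.trans h)]; trivial
  · rw [← hp .z ch trivial hch (hc.symm.trans h)]; trivial
  · obtain ⟨l, hc⟩ := RhoCalc.mem_namespaceOf.1 hc
    rw [← hp (.path l) ch trivial hch (hc.symm.trans h)]; trivial

theorem Diverges.exists_step {α : Type*} {r : α → α → Prop} {a : α} (h : Diverges r a) :
    ∃ b, r a b ∧ Diverges r b := by
  obtain ⟨f, rfl, h⟩ := h
  exact ⟨f 1, h 0, fun i => f (i + 1), rfl, fun i => h (i + 1)⟩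

theorem diverges_of_forall_exists {α : Type*} {r : α → α → Prop} {q : α → Prop}
    (h : ∀ a, q a → ∃ b, r a b ∧ q b) {a : α} (ha : q a) : Diverges r a := by
  choose g hg using h
  let f : ℕ → {a // q a} := fun i =>
    Nat.rec ⟨a, ha⟩ (fun _ b => ⟨g b.1 b.2, (hg b.1 b.2).2⟩) i
  exact ⟨fun i => (f i).1, rfl, fun i => (hg (f i).1 (f i).2).1⟩

/-- A divergent process does a communication after finitely many administrative steps. -/
theorem Simulation.exists_step {p : Params 𝒩} {S : Set 𝒩} (hp : p.Injective S)
    {K : List Op → Bool} {Q : PiCalc.Proc 𝒩 0} (w : ℕ) : ∀ {T : RhoCalc.Proc 0},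
    Simulation p S K T Q w → Diverges RhoCalc.Step T →
      ∃ Q', PiCalc.Step Q Q' ∧ ∃ T' w', Simulation p S K T' Q' w' ∧ Diverges RhoCalc.Step T' := by
  induction w using Nat.strong_induction_on with
  | _ w ih =>
    intro T h hd
    obtain ⟨T', hs, hd'⟩ := Diverges.exists_step hd
    obtain ⟨_, _, _, _, _, ⟨_, w', hw, h'⟩ | ⟨_, Q', w', hQ, h'⟩⟩ := h.step hp hs.stepOn_univ
    · exact ih w' hw h' hd'
    · exact ⟨Q', hQ, T', w', h', hd'⟩

/-- There is no infinite sequence of administrative steps. -/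
theorem Simulation.not_diverges {p : Params 𝒩} {S : Set 𝒩} (hp : p.Injective S)
    {K : List Op → Bool} {Q : PiCalc.Proc 𝒩 0} (w : ℕ) : ∀ {T : RhoCalc.Proc 0},
    Simulation p S K T Q w →
      ¬ Diverges (RhoCalc.StepOn (adminNames p.n p.v p.x p.z)) T := by
  induction w using Nat.strong_induction_on with
  | _ w ih =>
    intro T h hd
    obtain ⟨T', hs, hd'⟩ := Diverges.exists_step hd
    obtain ⟨c, hc, ch, hch, hcc, ⟨_, w', hw, h'⟩ | ⟨hna, _⟩⟩ := h.step hp hs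
    · exact ih w' hw h' hd'
    · exact hna (hp.admin hch hc hcc)

theorem Simulation.reachable {p : Params 𝒩} {S : Set 𝒩} (hp : p.Injective S)
    {K : List Op → Bool} {Q : PiCalc.Proc 𝒩 0} {w : ℕ} {T T' : RhoCalc.Proc 0}
    (h : Simulation p S K T Q w) (hs : Relation.ReflTransGen RhoCalc.Step T T') :
    ∃ Q' w', Simulation p S K T' Q' w' := by
  induction hs with
  | refl => exact ⟨Q, w, h⟩
  | tail _ hs ih =>
    obtain ⟨Q', w', h'⟩ := ih
    obtain ⟨_, _, _, _, _, ⟨_, w'', _, h''⟩ | ⟨_, Q'', w'', _, h''⟩⟩ :=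
      h'.step hp hs.stepOn_univ
    · exact ⟨Q', w'', h''⟩
    · exact ⟨Q'', w'', h''⟩

end PiToRho

theorem mainTheorem3 {𝒩 : Type*} (φ : 𝒩 → RhoCalc.Name 0)
    (hφ : ∀ a b, RhoCalc.Name.Equiv (φ a) (φ b) → a = b)
    (P : PiCalc.Proc 𝒩 0) (n v x z s : RhoCalc.Name 0)
    (h : PiToRho.Fresh φ P n v x z s) :
    (Diverges RhoCalc.Step (PiToRho.encode φ P n v x z s) → Diverges PiCalc.Step P) ∧
    (∀ T, Relation.ReflTransGen RhoCalc.Step (PiToRho.encode φ P n v x z s) T →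
      ¬ Diverges (RhoCalc.StepOn (PiToRho.adminNames n v x z)) T) := by
  have hp := h.injective hφ
  obtain ⟨K, hK⟩ := PiToRho.exists_procOK P.freeNames P subset_rfl
  obtain ⟨w, hw⟩ := PiToRho.Simulation.encode (φ := φ) hK n v x z s
  constructor
  · intro hd
    -- The invariant along the π-sequence is being simulated by some divergent ρ-process.
    refine PiToRho.diverges_of_forall_exists
      (q := fun Q => ∃ T w, PiToRho.Simulation ⟨φ, n, v, x, z, s⟩ P.freeNames K T Q w ∧
        Diverges RhoCalc.Step T) ?_ ⟨_, w, hw, hd⟩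
    rintro Q ⟨T, w, hT, hd⟩
    exact hT.exists_step hp w hd
  · intro T hT
    obtain ⟨Q, w', h'⟩ := hw.reachable hp hT
    exact h'.not_diverges hp w'
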